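/- Let $p,q\ge 1$ and let $X_1,\dots,X_n$ be independent, identically distributed random real $p\times q$ matrices whose common law is absolutely continuous with respect to Lebesgue measure on $\mathbb R^{p\times q}$. For a real $p\times q$ matrix $M$ and symmetric positive definite matrices $P$ ($p\times p$) and $Q$ ($q\times q$) put $$f(M,P,Q)=\frac1n\sum_{i=1}^n \operatorname{Tr}\bigl(P^{-1}(X_i-M)Q^{-1}(X_i-M)^\top\bigr)+\ln\det(P\otimes Q),$$ and let $\mathcal M$ be the set of pairs $(P,Q)$ of positive definite matrices with spectral norm $\|P\|_2=1$. Consider the minimization of $f$ over $M\in\mathbb R^{p\times q}$ and $(P,Q)\in\mathcal M$. With $\widehat M=\frac1n\sum_i X_i$ and $Y_i=X_i-\widehat M$, the Gaussian flip-flop (GFF) iteration started at $(P_0,Q_0)\in\mathcal M$ is, for $j\ge 0$, $$\widetilde P_{j+1}=\frac1{qn}\sum_{i}Y_iQ_j^{-1}Y_i^\top,\quad \widetilde Q_{j+1}=\frac1{pn}\sum_{i}Y_i^\top P_j^{-1}Y_i,\quad P_{j+1}=\frac{\widetilde P_{j+1}}{\|\widetilde P_{j+1}\|_2},\quad Q_{j+1}=\|\widetilde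 P_{j+1}\|_2\,\widetilde Q_{j+1}.$$ 1. If $n<\max(p/q,\,q/p)+1$, then, for every realization of the sample, $f$ has no unique minimum on $\mathbb R^{p\times q}\times\mathcal M$. 2. If $n>p/q+q/p+1$, then almost surely $f$ has a unique minimum on $\mathbb R^{p\times q}\times\mathcal M$. 3. If $n>p/q+q/p+1$, then almost surely, for every starting point $(P_0,Q_0)\in\mathcal M$, all GFF iterates are well defined and lie in $\mathcal M$, and the GFF converges to the unique minimum $(M^*,P^*,Q^*)$ in the following sense: as $j\to\infty$, the successive iterates satisfy $(\widehat M,P_j,\widetilde Q_{j+1})\to(M^*,P^*,Q^*)$, and also $Q_j/\|Q_j\|_2\to Q^*/\|Q^*\|_2$ (so $(P_j,Q_j)$ converges to $(P^*,Q^*)$ up to the scale of $Q_j$). -/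

import Mathlib

open MeasureTheory ProbabilityTheory Filter Topology
open scoped Kronecker

noncomputable section

namespace KroneckerMLE

variable {n p q : ℕ}

/-- The Borel (product) sigma-algebra on the space of real `p × q` matrices. -/
instance : MeasurableSpace (Matrix (Fin p) (Fin q) ℝ) :=
  inferInstanceAs (MeasurableSpace (Fin p → Fin q → ℝ))

/-- Lebesgue measure on the space of real `p × q` matrices: the product Lebesgue measure in the
matrix entries. -/
def matrixLebesgue (p q : ℕ) : Measure (Matrix (Fin p) (Fin q) ℝ) :=
  (volume : Measure (Fin p → Fin q → ℝ))

/-- The spectral norm `‖A‖₂` of a square matrix: the norm of the operator it induces on Euclidean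
space. -/
def specNorm {d : ℕ} (A : Matrix (Fin d) (Fin d) ℝ) : ℝ :=
  ‖Matrix.toEuclideanCLM (𝕜 := ℝ) A‖

/-- Pairs `(P, Q)` of positive definite matrices with `‖P‖₂ = 1`; they parametrize bijectively the
Kronecker products `P ⊗ Q` of positive definite matrices. -/
def covPairs (p q : ℕ) : Set (Matrix (Fin p) (Fin p) ℝ × Matrix (Fin q) (Fin q) ℝ) :=
  {PQ | PQ.1.PosDef ∧ PQ.2.PosDef ∧ specNorm PQ.1 = 1}

/-- The negative log-likelihood (up to an additive constant and scaling) of the matrix normal model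
with mean `M` and covariance `P ⊗ Q` at the samples `X 0, …, X (n - 1)`:
`(1/n) ∑ᵢ Tr (P⁻¹ (Xᵢ - M) Q⁻¹ (Xᵢ - M)ᵀ) + ln |P ⊗ Q|`. -/
def negLogLik (X : Fin n → Matrix (Fin p) (Fin q) ℝ) (M : Matrix (Fin p) (Fin q) ℝ)
    (P : Matrix (Fin p) (Fin p) ℝ) (Q : Matrix (Fin q) (Fin q) ℝ) : ℝ :=
  (1 / (n : ℝ)) * ∑ i, (P⁻¹ * (X i - M) * Q⁻¹ * (X i - M).transpose).trace
    + Real.log (P ⊗ₖ Q).det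

/-- `(M, (P, Q))` is a minimum of the negative log-likelihood over all real `p × q` matrices `M` and
all pairs `(P, Q)` in `covPairs p q`. -/
def IsMLE (X : Fin n → Matrix (Fin p) (Fin q) ℝ)
    (θ : Matrix (Fin p) (Fin q) ℝ × Matrix (Fin p) (Fin p) ℝ × Matrix (Fin q) (Fin q) ℝ) : Prop :=
  θ.2 ∈ covPairs p q ∧
    ∀ (M : Matrix (Fin p) (Fin q) ℝ), ∀ PQ ∈ covPairs p q,
      negLogLik X θ.1 θ.2.1 θ.2.2 ≤ negLogLik X M PQ.1 PQ.2

/-- The sample mean `(1/n) ∑ᵢ Xᵢ`. -/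
def sampleMean (X : Fin n → Matrix (Fin p) (Fin q) ℝ) : Matrix (Fin p) (Fin q) ℝ :=
  (1 / (n : ℝ)) • ∑ i, X i

/-- The flip-flop update of `P`: with `Yᵢ = Xᵢ - sampleMean X`, it is
`(1/(qn)) ∑ᵢ Yᵢ Q⁻¹ Yᵢᵀ`. -/
def updateP (X : Fin n → Matrix (Fin p) (Fin q) ℝ) (Q : Matrix (Fin q) (Fin q) ℝ) :
    Matrix (Fin p) (Fin p) ℝ :=
  (1 / ((q : ℝ) * n)) • ∑ i, (X i - sampleMean X) * Q⁻¹ * (X i - sampleMean X).transpose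

/-- The flip-flop update of `Q`: with `Yᵢ = Xᵢ - sampleMean X`, it is
`(1/(pn)) ∑ᵢ Yᵢᵀ P⁻¹ Yᵢ`. -/
def updateQ (X : Fin n → Matrix (Fin p) (Fin q) ℝ) (P : Matrix (Fin p) (Fin p) ℝ) :
    Matrix (Fin q) (Fin q) ℝ :=
  (1 / ((p : ℝ) * n)) • ∑ i, (X i - sampleMean X).transpose * P⁻¹ * (X i - sampleMean X)

/-- One step of the normalized Gaussian flip-flop iteration: both factors are updated from the
current pair, then the new pair is rescaled so that its first entry has spectral norm one. -/
def flipFlopStep (X : Fin n → Matrix (Fin p) (Fin q) ℝ)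
    (PQ : Matrix (Fin p) (Fin p) ℝ × Matrix (Fin q) (Fin q) ℝ) :
    Matrix (Fin p) (Fin p) ℝ × Matrix (Fin q) (Fin q) ℝ :=
  ((specNorm (updateP X PQ.2))⁻¹ • updateP X PQ.2, specNorm (updateP X PQ.2) • updateQ X PQ.1)

/-- The `j`-th pair `(P_j, Q_j)` of the normalized Gaussian flip-flop iteration started at `PQ₀`. -/
def flipFlop (X : Fin n → Matrix (Fin p) (Fin q) ℝ)
    (PQ₀ : Matrix (Fin p) (Fin p) ℝ × Matrix (Fin q) (Fin q) ℝ) (j : ℕ) :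
    Matrix (Fin p) (Fin p) ℝ × Matrix (Fin q) (Fin q) ℝ :=
  (flipFlopStep X)^[j] PQ₀

end KroneckerMLE

end

/-! The trace part of the likelihood splits off the mean (`negLogLik_eq`), so $M=\widehat M$ is
optimal and only the centered samples $Y_i$ matter. Everything above the upper threshold rests on
one deterministic condition, `Stable`: a common $r\times t$ zero block of the $Y_i$ in any bases has
$r/p+t/q<1$.

Under stability, a common fixed point of the two updates is a global minimum, unique up to
$(cP,c^{-1}Q)$ (`objective_le_of_fixed`). Diagonalizing a competitor simultaneously with the fixed
point turns the gap of the objectives into a weighted sum of terms $x-1-\ln x\ge 0$; a vanishing gap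
with non-scalar ratios would produce a forbidden zero block. A fixed point exists because the
objective minimized over $Q$, `profile`, has compact sublevel sets on $\|P\|_2=1$
(`Stable.exists_profile_coercive`). Coercivity comes from choosing $q$ independent rows of the
rotated samples, favouring small eigenvalues of $P$, and summing by parts.

Both factors are updated at once, so $P_{j+2}$ depends on $P_j$ alone: the even and odd subsequences
are two independent alternating minimizations. The profile strictly decreases off fixed points,
hence each subsequence has the unique fixed point as its only cluster point
(`tendsto_iterate_doubleStep`).

Stability is almost sure by counting dimensions: samples with a forbidden block form a finite union
of smooth images of spaces of too small dimension (`volume_not_stable`); the count closes exactly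
when $n-1>p/q+q/p$.

Below the lower threshold the $n-1$ free centered samples have a common left or right kernel vector,
and moving the covariance along it always lowers the objective, so there is no minimum at all
(`not_isMLE_of_lt`). -/

namespace KroneckerMLE

/-! ### Simultaneous diagonalization and determinant inequalities. -/

section SquareMatrices

open Matrix

variable {m : Type*} [Fintype m] [DecidableEq m]

theorem exists_orthogonal_diagonalization {H : Matrix m m ℝ} (hH : H.IsHermitian) :
    ∃ (O : Matrix m m ℝ) (d : m → ℝ), Oᵀ * O = 1 ∧ O * Oᵀ = 1 ∧ H = O * diagonal d * Oᵀ := by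
  refine ⟨hH.eigenvectorUnitary, hH.eigenvalues, ?_, ?_, ?_⟩
  · have := Unitary.coe_star_mul_self hH.eigenvectorUnitary
    simpa [star_eq_conjTranspose] using this
  · have := Unitary.coe_mul_star_self hH.eigenvectorUnitary
    simpa [star_eq_conjTranspose] using this
  · have := hH.spectral_theorem
    rw [Unitary.conjStarAlgAut_apply] at this
    simpa [star_eq_conjTranspose, Function.comp_def] using this

theorem _root_.Matrix.PosDef.exists_eq_mul_transpose {A : Matrix m m ℝ} (hA : A.PosDef) :
    ∃ C : Matrix m m ℝ, IsUnit C.det ∧ A = C * Cᵀ := by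
  obtain ⟨O, d, hO, hO', h⟩ := exists_orthogonal_diagonalization hA.isHermitian
  have hd : ∀ i, 0 < d i := by
    have h1 : (Oᵀ * A * O).PosDef := by
      have := hA.conjTranspose_mul_mul_same (B := O) (by
        intro x y hxy
        have := congrArg (fun v => Oᵀ *ᵥ v) hxy
        simpa [mulVec_mulVec, hO] using this)
      simpa using this
    have h2 : Oᵀ * A * O = diagonal d := by
      rw [h]
      calc Oᵀ * (O * diagonal d * Oᵀ) * O = (Oᵀ * O) * diagonal d * (Oᵀ * O) := by
            simp only [Matrix.mul_assoc]
        _ = diagonal d := by rw [hO]; simp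
    rw [h2] at h1
    exact posDef_diagonal_iff.1 h1
  have hC : A = (O * diagonal fun i => √(d i)) * (O * diagonal fun i => √(d i))ᵀ := by
    rw [transpose_mul, diagonal_transpose, Matrix.mul_assoc, ← Matrix.mul_assoc (diagonal _),
      diagonal_mul_diagonal]
    simp only [Real.mul_self_sqrt (hd _).le]
    rw [h, Matrix.mul_assoc]
  refine ⟨_, ?_, hC⟩
  have h1 := hA.det_pos
  rw [hC, det_mul, det_transpose] at h1
  exact isUnit_iff_ne_zero.2 fun h0 => by simp [h0] at h1

/-- A positive definite and a symmetric matrix can be diagonalized by the same congruence. -/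
theorem exists_simultaneous_diagonalization {A H : Matrix m m ℝ} (hA : A.PosDef)
    (hH : H.IsHermitian) :
    ∃ (C : Matrix m m ℝ) (d : m → ℝ), IsUnit C.det ∧ A = C * Cᵀ ∧ H = C * diagonal d * Cᵀ := by
  obtain ⟨C, hC, rfl⟩ := hA.exists_eq_mul_transpose
  have hK : (C⁻¹ * H * (C⁻¹)ᵀ).IsHermitian := by
    have := isHermitian_mul_mul_conjTranspose C⁻¹ hH
    simpa using this
  obtain ⟨O, d, hO, hO', h⟩ := exists_orthogonal_diagonalization hK
  refine ⟨C * O, d, ?_, ?_, ?_⟩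
  · rw [det_mul]
    refine hC.mul ?_
    have := congrArg det hO
    rw [det_mul, det_one] at this
    exact IsUnit.of_mul_eq_one _ (by rw [mul_comm]; exact this)
  · rw [transpose_mul, Matrix.mul_assoc, ← Matrix.mul_assoc O, hO', Matrix.one_mul]
  · calc H = (C * C⁻¹) * H * (C * C⁻¹)ᵀ := by rw [mul_nonsing_inv _ hC]; simp
      _ = C * (C⁻¹ * H * (C⁻¹)ᵀ) * Cᵀ := by rw [transpose_mul]; simp only [Matrix.mul_assoc]
      _ = C * O * diagonal d * (C * O)ᵀ := by
        rw [h, transpose_mul]; simp only [Matrix.mul_assoc]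

theorem posDef_congr_diagonal_iff {C : Matrix m m ℝ} (hC : IsUnit C.det) (d : m → ℝ) :
    (C * diagonal d * Cᵀ).PosDef ↔ ∀ i, 0 < d i := by
  have := Matrix.IsUnit.posDef_star_right_conjugate_iff (U := C) (x := diagonal d)
    ((isUnit_iff_isUnit_det _).2 hC)
  rw [star_eq_conjTranspose, conjTranspose_eq_transpose_of_trivial] at this
  rw [this, posDef_diagonal_iff]

theorem posSemidef_congr_diagonal_iff {C : Matrix m m ℝ} (hC : IsUnit C.det) (d : m → ℝ) :
    (C * diagonal d * Cᵀ).PosSemidef ↔ ∀ i, 0 ≤ d i := by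
  have := Matrix.IsUnit.posSemidef_star_right_conjugate_iff (U := C) (x := diagonal d)
    ((isUnit_iff_isUnit_det _).2 hC)
  rw [star_eq_conjTranspose, conjTranspose_eq_transpose_of_trivial] at this
  rw [this, posSemidef_diagonal_iff]

theorem det_congr_diagonal (C : Matrix m m ℝ) (d : m → ℝ) :
    (C * diagonal d * Cᵀ).det = (C * Cᵀ).det * ∏ i, d i := by
  simp only [det_mul, det_diagonal, det_transpose]; ring

theorem log_det_congr_diagonal {C : Matrix m m ℝ} (hC : IsUnit C.det) {d : m → ℝ}
    (hd : ∀ i, 0 < d i) :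
    Real.log (C * diagonal d * Cᵀ).det = Real.log (C * Cᵀ).det + ∑ i, Real.log (d i) := by
  rw [det_congr_diagonal, Real.log_mul, Real.log_prod]
  · exact fun i _ => (hd i).ne'
  · rw [det_mul, det_transpose]
    exact mul_ne_zero hC.ne_zero hC.ne_zero
  · exact Finset.prod_ne_zero_iff.2 fun i _ => (hd i).ne'

theorem log_le_sub_one_eq_iff {x : ℝ} (hx : 0 < x) : x - 1 - Real.log x = 0 ↔ x = 1 := by
  constructor
  · intro h
    by_contra hne
    have := Real.log_lt_sub_one_of_pos hx hne
    linarith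
  · rintro rfl; simp

/-- For fixed `A`, the function `Q ↦ tr (Q⁻¹ A) + log det Q` is minimal exactly at `Q = A`. -/
theorem card_add_log_det_le {A Q : Matrix m m ℝ} (hA : A.PosDef) (hQ : Q.PosDef) :
    Fintype.card m + Real.log A.det ≤ (Q⁻¹ * A).trace + Real.log Q.det ∧
      (Fintype.card m + Real.log A.det = (Q⁻¹ * A).trace + Real.log Q.det → A = Q) := by
  obtain ⟨C, d, hC, rfl, rfl⟩ := exists_simultaneous_diagonalization hQ hA.isHermitian
  have hd := (posDef_congr_diagonal_iff hC d).1 hA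
  have htr : ((C * Cᵀ)⁻¹ * (C * diagonal d * Cᵀ)).trace = ∑ i, d i := by
    rw [Matrix.mul_inv_rev, Matrix.mul_assoc C, ← Matrix.mul_assoc _ C, Matrix.mul_assoc _ _ C,
      nonsing_inv_mul _ hC, Matrix.mul_one, trace_mul_comm, Matrix.mul_assoc,
      mul_nonsing_inv _ (by rwa [det_transpose]), Matrix.mul_one, trace_diagonal]
  rw [htr, log_det_congr_diagonal hC hd]
  -- In the common basis the difference of the two sides is a sum of terms `x - 1 - log x`, each
  -- nonnegative and zero only at `x = 1`.
  have hsum : ∑ i, (d i - 1 - Real.log (d i)) =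
      ∑ i, d i - Fintype.card m - ∑ i, Real.log (d i) := by
    simp [Finset.sum_sub_distrib]
  have hnn : ∀ i ∈ Finset.univ, 0 ≤ d i - 1 - Real.log (d i) := fun i _ => by
    have := Real.log_le_sub_one_of_pos (hd i)
    linarith
  constructor
  · have := Finset.sum_nonneg hnn
    linarith
  · intro h
    have h0 : ∑ i, (d i - 1 - Real.log (d i)) = 0 := by linarith
    rw [Finset.sum_eq_zero_iff_of_nonneg hnn] at h0
    have : d = fun _ => 1 := funext fun i =>
      (log_le_sub_one_eq_iff (hd i)).1 (h0 i (Finset.mem_univ i))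
    rw [this]; simp

theorem _root_.Matrix.PosDef.det_le_det_add {A B : Matrix m m ℝ} (hA : A.PosDef)
    (hB : B.PosSemidef) : A.det ≤ (A + B).det ∧ (B ≠ 0 → A.det < (A + B).det) := by
  have hApos := hA.det_pos
  obtain ⟨C, d, hC, rfl, rfl⟩ := exists_simultaneous_diagonalization hA hB.isHermitian
  have hd := (posSemidef_congr_diagonal_iff hC d).1 hB
  have hsum : C * Cᵀ + C * diagonal d * Cᵀ = C * diagonal (fun i => 1 + d i) * Cᵀ := by
    rw [← diagonal_add, diagonal_one, Matrix.mul_add, Matrix.add_mul, Matrix.mul_one]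
  rw [hsum, det_congr_diagonal]
  have h1 : ∀ i ∈ Finset.univ, 1 ≤ 1 + d i := fun i _ => by linarith [hd i]
  refine ⟨le_mul_of_one_le_right hApos.le (by
    simpa using Finset.prod_le_prod (s := Finset.univ) (fun _ _ => zero_le_one) h1), fun hne => ?_⟩
  refine lt_mul_of_one_lt_right hApos ?_
  obtain ⟨i, hi⟩ : ∃ i, d i ≠ 0 := by
    by_contra! h
    apply hne
    rw [show d = 0 from funext h]
    simp
  calc (1 : ℝ) = ∏ _i : m, 1 := by simp
    _ < ∏ i, (1 + d i) := Finset.prod_lt_prod (fun _ _ => one_pos) h1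
      ⟨i, Finset.mem_univ i, by have := lt_of_le_of_ne (hd i) (Ne.symm hi); linarith⟩

end SquareMatrices

/-! ### The spectral norm. -/

section SpectralNorm

open Matrix
open scoped Matrix.Norms.L2Operator

variable {d : ℕ}

theorem specNorm_eq_norm (A : Matrix (Fin d) (Fin d) ℝ) : specNorm A = ‖A‖ := rfl

theorem continuous_specNorm : Continuous (specNorm (d := d)) := by
  have : (specNorm (d := d)) = fun A => ‖A‖ := rfl
  rw [this]
  exact continuous_norm

theorem specNorm_smul_of_nonneg {c : ℝ} (hc : 0 ≤ c) (A : Matrix (Fin d) (Fin d) ℝ) :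
    specNorm (c • A) = c * specNorm A := by
  rw [specNorm_eq_norm, norm_smul, Real.norm_of_nonneg hc]; rfl

theorem specNorm_pos_of_posDef (hd : 0 < d) {A : Matrix (Fin d) (Fin d) ℝ} (hA : A.PosDef) :
    0 < specNorm A := by
  rw [specNorm_eq_norm, norm_pos_iff]
  rintro rfl
  have : Nonempty (Fin d) := ⟨⟨0, hd⟩⟩
  have := hA.det_pos
  simp at this

theorem isCompact_specNorm_le (r : ℝ) :
    IsCompact {A : Matrix (Fin d) (Fin d) ℝ | specNorm A ≤ r} := by
  have : ProperSpace (Matrix (Fin d) (Fin d) ℝ) := FiniteDimensional.proper ℝ _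
  have h : {A : Matrix (Fin d) (Fin d) ℝ | specNorm A ≤ r} = Metric.closedBall 0 r := by
    ext A
    rw [mem_closedBall_zero_iff]
    rfl
  rw [h]
  exact isCompact_closedBall (0 : Matrix (Fin d) (Fin d) ℝ) r

theorem specNorm_orthogonal_conj_le {O : Matrix (Fin d) (Fin d) ℝ} (hO : Oᵀ * O = 1)
    {v : Fin d → ℝ} {r : ℝ} (hr : 0 ≤ r) (hv : ∀ i, |v i| ≤ r) :
    specNorm (O * diagonal v * Oᵀ) ≤ r := by
  rw [specNorm_eq_norm]
  have h1 : ‖O‖ ≤ 1 ∧ ‖Oᵀ‖ ≤ 1 := by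
    have h2 : ‖Oᴴ * O‖ = ‖O‖ * ‖O‖ := l2_opNorm_conjTranspose_mul_self O
    rw [conjTranspose_eq_transpose_of_trivial, hO] at h2
    have h3 : ‖Oᴴ‖ = ‖O‖ := l2_opNorm_conjTranspose O
    rw [conjTranspose_eq_transpose_of_trivial] at h3
    have h4 : ‖(1 : Matrix (Fin d) (Fin d) ℝ)‖ ≤ 1 := by
      rw [← diagonal_one, l2_opNorm_diagonal]
      exact (pi_norm_le_iff_of_nonneg zero_le_one).2 fun i => by simp
    have : ‖O‖ ≤ 1 := by nlinarith [norm_nonneg O]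
    exact ⟨this, h3.trans_le this⟩
  have h5 : ‖(diagonal v : Matrix (Fin d) (Fin d) ℝ)‖ ≤ r := by
    rw [l2_opNorm_diagonal]
    exact (pi_norm_le_iff_of_nonneg hr).2 hv
  calc ‖O * diagonal v * Oᵀ‖ ≤ ‖O * diagonal v‖ * ‖Oᵀ‖ := norm_mul_le _ _
    _ ≤ (‖O‖ * ‖(diagonal v : Matrix (Fin d) (Fin d) ℝ)‖) * ‖Oᵀ‖ := by
      gcongr; exact norm_mul_le _ _
    _ ≤ (1 * r) * 1 := by gcongr; exacts [h1.1, h1.2]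
    _ = r := by ring

end SpectralNorm

/-! ### The centered objective, stability, and optimality of fixed points. -/

section Objective

open Matrix

variable {n p q : ℕ}

/-- The update of the row covariance for fixed column covariance `Q` and centered samples `Y`. -/
noncomputable def rowUpdate (Y : Fin n → Matrix (Fin p) (Fin q) ℝ) (Q : Matrix (Fin q) (Fin q) ℝ) :
    Matrix (Fin p) (Fin p) ℝ :=
  (1 / ((q : ℝ) * n)) • ∑ i, Y i * Q⁻¹ * (Y i)ᵀ

/-- The negative log-likelihood of the centered samples `Y` at mean zero. -/
noncomputable def objective (Y : Fin n → Matrix (Fin p) (Fin q) ℝ) (P : Matrix (Fin p) (Fin p) ℝ)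
    (Q : Matrix (Fin q) (Fin q) ℝ) : ℝ :=
  (1 / (n : ℝ)) * ∑ i, (P⁻¹ * Y i * Q⁻¹ * (Y i)ᵀ).trace
    + (q * Real.log P.det + p * Real.log Q.det)

/-- Every block of zeros that is common to the matrices `Y i`, after arbitrary changes of bases of
the row and of the column space, is small: an `r × t` block satisfies `r / p + t / q < 1`. -/
def Stable (Y : Fin n → Matrix (Fin p) (Fin q) ℝ) : Prop :=
  ∀ (r t : ℕ) (u : Fin r → Fin p → ℝ) (v : Fin t → Fin q → ℝ),
    LinearIndependent ℝ u → LinearIndependent ℝ v → 0 < r → 0 < t →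
    (∀ i k l, u k ⬝ᵥ (Y i *ᵥ v l) = 0) → r * q + t * p < p * q

theorem Stable.transpose {Y : Fin n → Matrix (Fin p) (Fin q) ℝ} (hY : Stable Y) :
    Stable fun i => (Y i)ᵀ := by
  intro r t u v hu hv hr ht h
  have := hY t r v u hv hu ht hr fun i k l => by
    rw [← h i l k, mulVec_transpose, dotProduct_mulVec, dotProduct_comm]
  linarith [mul_comm p q]

theorem Stable.card_lt {Y : Fin n → Matrix (Fin p) (Fin q) ℝ} (hY : Stable Y) {κ τ : Type*}
    [Fintype κ] [Fintype τ] [Nonempty κ] [Nonempty τ] {u : κ → Fin p → ℝ} {v : τ → Fin q → ℝ}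
    (hu : LinearIndependent ℝ u) (hv : LinearIndependent ℝ v)
    (h : ∀ i k l, u k ⬝ᵥ (Y i *ᵥ v l) = 0) :
    Fintype.card κ * q + Fintype.card τ * p < p * q :=
  hY _ _ (u ∘ (Fintype.equivFin κ).symm) (v ∘ (Fintype.equivFin τ).symm)
    (hu.comp _ (Equiv.injective _)) (hv.comp _ (Equiv.injective _)) Fintype.card_pos
    Fintype.card_pos fun i _ _ => h i _ _

theorem linearIndependent_transpose_of_isUnit_det {d : ℕ} {A : Matrix (Fin d) (Fin d) ℝ}
    (hA : IsUnit A.det) : LinearIndependent ℝ Aᵀ.row :=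
  linearIndependent_rows_of_isUnit ((isUnit_iff_isUnit_det _).2 (by rwa [det_transpose]))

theorem Stable.finset_card_lt {Y : Fin n → Matrix (Fin p) (Fin q) ℝ} (hY : Stable Y)
    {A : Matrix (Fin p) (Fin p) ℝ} {B : Matrix (Fin q) (Fin q) ℝ} (hA : IsUnit A.det)
    (hB : IsUnit B.det) {K : Finset (Fin p)} {L : Finset (Fin q)} (hK : K.Nonempty)
    (hL : L.Nonempty) (h : ∀ i, ∀ k ∈ K, ∀ l ∈ L, (Aᵀ * Y i * B) k l = 0) :
    K.card * q + L.card * p < p * q := by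
  have := hK.to_subtype
  have := hL.to_subtype
  have := hY.card_lt (κ := K) (τ := L)
    ((linearIndependent_transpose_of_isUnit_det hA).comp _ Subtype.val_injective)
    ((linearIndependent_transpose_of_isUnit_det hB).comp _ Subtype.val_injective)
    (fun i k l => by
      rw [← h i k k.2 l l.2, Matrix.mul_assoc]
      rfl)
  simpa using this

/-- A null direction of the update would annihilate every `Y i` from the left, giving a common `1 ×
q` zero block, which stability forbids. -/
theorem rowUpdate_posDef (hn : 0 < n) (hq : 0 < q)
    {Y : Fin n → Matrix (Fin p) (Fin q) ℝ}
    (hY : Stable Y) {Q : Matrix (Fin q) (Fin q) ℝ} (hQ : Q.PosDef) : (rowUpdate Y Q).PosDef := by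
  have hc : 0 < 1 / ((q : ℝ) * n) := by positivity
  refine PosDef.smul ?_ hc
  have hsemi : ∀ i, (Y i * Q⁻¹ * (Y i)ᵀ).PosSemidef := fun i => by
    have := hQ.inv.posSemidef.mul_mul_conjTranspose_same (Y i)
    simpa using this
  have hS := posSemidef_sum (x := fun i => Y i * Q⁻¹ * (Y i)ᵀ) Finset.univ fun i _ => hsemi i
  obtain ⟨C, hC, hQC⟩ := hQ.inv.exists_eq_mul_transpose
  obtain ⟨O, d, hO, hO', hd⟩ := exists_orthogonal_diagonalization hS.isHermitian
  have hOu : IsUnit O.det := by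
    have := congrArg det hO'
    rw [det_mul, det_one] at this
    exact IsUnit.of_mul_eq_one _ this
  have hdiag : ∑ i, (Oᵀ * Y i * C) * (Oᵀ * Y i * C)ᵀ = diagonal d := by
    calc ∑ i, (Oᵀ * Y i * C) * (Oᵀ * Y i * C)ᵀ = Oᵀ * (∑ i, Y i * Q⁻¹ * (Y i)ᵀ) * O := by
          rw [Finset.mul_sum, Finset.sum_mul, hQC]
          refine Finset.sum_congr rfl fun i _ => ?_
          simp only [transpose_mul, transpose_transpose, Matrix.mul_assoc]
      _ = (Oᵀ * O) * diagonal d * (Oᵀ * O) := by rw [hd]; simp only [Matrix.mul_assoc]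
      _ = diagonal d := by rw [hO]; simp
  rw [hd] at hS ⊢
  refine (posDef_congr_diagonal_iff hOu d).2 fun k => ?_
  refine lt_of_le_of_ne ((posSemidef_congr_diagonal_iff hOu d).1 hS k) fun h0 => ?_
  have hk : ∑ i, ∑ l, (Oᵀ * Y i * C) k l ^ 2 = 0 := by
    have := congrFun (congrFun hdiag k) k
    rw [diagonal_apply_eq, ← h0, Matrix.sum_apply] at this
    rw [← this]
    refine Finset.sum_congr rfl fun i _ => ?_
    rw [mul_apply]
    exact Finset.sum_congr rfl fun l _ => by rw [transpose_apply, sq]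
  have hzero : ∀ i l, (Oᵀ * Y i * C) k l = 0 := fun i l => by
    rw [Finset.sum_eq_zero_iff_of_nonneg
      fun i _ => Finset.sum_nonneg fun l _ => sq_nonneg _] at hk
    have := hk i (Finset.mem_univ i)
    rw [Finset.sum_eq_zero_iff_of_nonneg fun l _ => sq_nonneg _] at this
    exact pow_eq_zero_iff two_ne_zero |>.1 (this l (Finset.mem_univ l))
  have : Nonempty (Fin q) := ⟨⟨0, hq⟩⟩
  have := hY.finset_card_lt hOu hC (K := {k}) (L := Finset.univ) ⟨k, by simp⟩
    Finset.univ_nonempty (fun i k' hk' l _ => by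
      rw [Finset.mem_singleton.1 hk']; exact hzero i l)
  simp [mul_comm] at this

theorem objective_transpose (Y : Fin n → Matrix (Fin p) (Fin q) ℝ) (P : Matrix (Fin p) (Fin p) ℝ)
    (Q : Matrix (Fin q) (Fin q) ℝ) :
    objective (fun i => (Y i)ᵀ) Q P = objective Y P Q := by
  unfold objective
  rw [add_comm (_ * Real.log Q.det)]
  congr 2
  refine Finset.sum_congr rfl fun i _ => ?_
  rw [transpose_transpose, Matrix.mul_assoc, trace_mul_comm, ← Matrix.mul_assoc]

theorem objective_eq (hn : 0 < n) (hq : 0 < q) (Y : Fin n → Matrix (Fin p) (Fin q) ℝ)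
    (P : Matrix (Fin p) (Fin p) ℝ) (Q : Matrix (Fin q) (Fin q) ℝ) :
    objective Y P Q =
      q * ((P⁻¹ * rowUpdate Y Q).trace + Real.log P.det) + p * Real.log Q.det := by
  unfold objective rowUpdate
  rw [Matrix.mul_smul, trace_smul, Matrix.mul_sum, trace_sum, smul_eq_mul]
  simp only [Matrix.mul_assoc]
  field_simp
  ring

/-- Each update is an exact partial minimization, by `card_add_log_det_le`; strictness off the
minimizer later makes the iteration a strict descent. -/
theorem objective_rowUpdate_le (hn : 0 < n) (hq : 0 < q)
    {Y : Fin n → Matrix (Fin p) (Fin q) ℝ} (hY : Stable Y) {P : Matrix (Fin p) (Fin p) ℝ}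
    {Q : Matrix (Fin q) (Fin q) ℝ} (hP : P.PosDef) (hQ : Q.PosDef) :
    objective Y (rowUpdate Y Q) Q ≤ objective Y P Q ∧
      (objective Y P Q ≤ objective Y (rowUpdate Y Q) Q → P = rowUpdate Y Q) := by
  have hU := rowUpdate_posDef hn hq hY hQ
  obtain ⟨h1, h2⟩ := card_add_log_det_le hU hP
  have h3 : ((rowUpdate Y Q)⁻¹ * rowUpdate Y Q).trace = (Fintype.card (Fin p) : ℝ) := by
    rw [nonsing_inv_mul _ ((isUnit_iff_isUnit_det _).1 hU.isUnit), trace_one]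
  rw [objective_eq hn hq, objective_eq hn hq, h3]
  have hq' : (0 : ℝ) < q := by positivity
  refine ⟨by gcongr, fun h => (h2 (le_antisymm h1 ?_)).symm⟩
  have := le_of_add_le_add_right h
  exact le_of_mul_le_mul_left this hq'

theorem inv_smul_of_pos {d : ℕ} {c : ℝ} (hc : 0 < c) {A : Matrix (Fin d) (Fin d) ℝ}
    (hA : A.PosDef) : (c • A)⁻¹ = c⁻¹ • A⁻¹ := by
  have := Matrix.inv_smul' A (Units.mk0 c hc.ne') ((isUnit_iff_isUnit_det _).1 hA.isUnit)
  simpa [Units.smul_def] using this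

theorem rowUpdate_smul {Y : Fin n → Matrix (Fin p) (Fin q) ℝ} {c : ℝ} (hc : 0 < c)
    {Q : Matrix (Fin q) (Fin q) ℝ} (hQ : Q.PosDef) :
    rowUpdate Y (c • Q) = c⁻¹ • rowUpdate Y Q := by
  unfold rowUpdate
  rw [inv_smul_of_pos hc hQ, smul_comm, Finset.smul_sum (r := c⁻¹)]
  simp

theorem objective_smul {Y : Fin n → Matrix (Fin p) (Fin q) ℝ} {c : ℝ} (hc : 0 < c)
    {P : Matrix (Fin p) (Fin p) ℝ} {Q : Matrix (Fin q) (Fin q) ℝ} (hP : P.PosDef)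
    (hQ : Q.PosDef) : objective Y (c • P) (c⁻¹ • Q) = objective Y P Q := by
  have hc' : 0 < c⁻¹ := inv_pos.2 hc
  unfold objective
  rw [inv_smul_of_pos hc hP, inv_smul_of_pos hc' hQ, det_smul, det_smul,
    Real.log_mul (by positivity) hP.det_pos.ne', Real.log_mul (by positivity) hQ.det_pos.ne']
  simp only [Matrix.smul_mul, Matrix.mul_smul, smul_smul, inv_inv, mul_inv_cancel₀ hc.ne',
    one_smul, Real.log_pow, Real.log_inv, Fintype.card_fin]
  ring

theorem sum_trace_congr_diagonal (Y : Fin n → Matrix (Fin p) (Fin q) ℝ)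
    (A : Matrix (Fin p) (Fin p) ℝ) (B : Matrix (Fin q) (Fin q) ℝ) (a : Fin p → ℝ)
    (b : Fin q → ℝ) :
    ∑ i, (A * diagonal a * Aᵀ * Y i * (B * diagonal b * Bᵀ) * (Y i)ᵀ).trace =
      ∑ k, ∑ l, (∑ i, (Aᵀ * Y i * B) k l ^ 2) * (a k * b l) := by
  have h : ∀ i, (A * diagonal a * Aᵀ * Y i * (B * diagonal b * Bᵀ) * (Y i)ᵀ).trace =
      ∑ k, ∑ l, (Aᵀ * Y i * B) k l ^ 2 * (a k * b l) := fun i => by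
    have h1 : A * diagonal a * Aᵀ * Y i * (B * diagonal b * Bᵀ) * (Y i)ᵀ =
        A * (diagonal a * (Aᵀ * Y i * B) * (diagonal b * Bᵀ * (Y i)ᵀ)) := by
      simp only [Matrix.mul_assoc]
    have h2 : diagonal a * (Aᵀ * Y i * B) * (diagonal b * Bᵀ * (Y i)ᵀ) * A =
        diagonal a * ((Aᵀ * Y i * B) * diagonal b * (Aᵀ * Y i * B)ᵀ) := by
      simp only [Matrix.mul_assoc, transpose_mul, transpose_transpose]
    rw [h1, trace_mul_comm, h2]
    simp only [trace, diag_apply, diagonal_mul]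
    refine Finset.sum_congr rfl fun k _ => ?_
    rw [mul_apply, Finset.mul_sum]
    refine Finset.sum_congr rfl fun l _ => ?_
    rw [mul_diagonal, transpose_apply]
    ring
  simp_rw [h, Finset.sum_mul]
  rw [Finset.sum_comm]
  exact Finset.sum_congr rfl fun k _ => Finset.sum_comm

/-- A nonnegative matrix with constant row and column sums and without large blocks of zeros cannot
be supported on a proper block structure. -/
theorem eq_const_of_support {M : Fin p → Fin q → ℝ} {s : ℝ} (hs : 0 < s) (hp : 0 < p) (hq : 0 < q)
    (hrow : ∀ k, ∑ l, M k l = q * s) (hcol : ∀ l, ∑ k, M k l = p * s)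
    (hblock : ∀ (K : Finset (Fin p)) (L : Finset (Fin q)), K.Nonempty → L.Nonempty →
      (∀ k ∈ K, ∀ l ∈ L, M k l = 0) → K.card * q + L.card * p < p * q)
    {a : Fin p → ℝ} {b : Fin q → ℝ} (ha : ∀ k, 0 < a k)
    (hab : ∀ k l, M k l ≠ 0 → a k * b l = 1) :
    ∃ c, 0 < c ∧ (∀ k, a k = c) ∧ ∀ l, b l = c⁻¹ := by
  classical
  have hqs : (0 : ℝ) < q * s := by positivity
  set α := a ⟨0, hp⟩ with hα
  have hαpos : 0 < α := ha _
  refine ⟨α, hαpos, ?_⟩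
  have hb : ∀ k l, M k l ≠ 0 → b l = (a k)⁻¹ := fun k l h =>
    eq_inv_of_mul_eq_one_right (hab k l h)
  -- `M` vanishes on `K × L` and on `Kᶜ × Lᶜ`, so the rows in `K` and the columns in `Lᶜ` carry the
  -- same mass: `|K| q = |Lᶜ| p`. For nonempty `L` this gives `|K| q + |L| p = p q`, the boundary
  -- case excluded by `hblock`.
  let K := Finset.univ.filter fun k => a k = α
  let L := Finset.univ.filter fun l => b l ≠ α⁻¹
  have hKL : ∀ k ∈ K, ∀ l ∈ L, M k l = 0 := fun k hk l hl => by
    by_contra h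
    refine (Finset.mem_filter.1 hl).2 ?_
    rw [hb k l h, (Finset.mem_filter.1 hk).2]
  have hKL' : ∀ k ∉ K, ∀ l ∉ L, M k l = 0 := fun k hk l hl => by
    by_contra h
    have h1 : b l = α⁻¹ := by simpa [L] using hl
    have h2 := hb k l h
    exact hk (Finset.mem_filter.2 ⟨Finset.mem_univ _, inv_injective (h2.symm.trans h1)⟩)
  by_cases hL : L.Nonempty
  · exfalso
    have h1 := hblock K L ⟨⟨0, hp⟩, by simp [K, hα]⟩ hL hKL
    have h2 : ∑ k ∈ K, ∑ l, M k l = ∑ k ∈ K, ∑ l ∈ Lᶜ, M k l := by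
      refine Finset.sum_congr rfl fun k hk => ?_
      rw [← Finset.sum_add_sum_compl L, Finset.sum_eq_zero (hKL k hk), zero_add]
    have h3 : ∑ l ∈ Lᶜ, ∑ k, M k l = ∑ l ∈ Lᶜ, ∑ k ∈ K, M k l := by
      refine Finset.sum_congr rfl fun l hl => ?_
      rw [← Finset.sum_add_sum_compl K, Finset.sum_eq_zero (s := Kᶜ), add_zero]
      exact fun k hk => hKL' k (Finset.mem_compl.1 hk) l (Finset.mem_compl.1 hl)
    rw [Finset.sum_comm (t := Lᶜ), ← h3] at h2
    simp only [hrow, hcol, Finset.sum_const, nsmul_eq_mul] at h2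
    have h4 : (Lᶜ.card : ℝ) + L.card = q := by
      have := Finset.card_compl_add_card L
      rw [Fintype.card_fin] at this
      exact_mod_cast this
    have h5 : (K.card : ℝ) * q = Lᶜ.card * p := by
      have : s * ((K.card : ℝ) * q) = s * (Lᶜ.card * p) := by linarith
      exact mul_left_cancel₀ hs.ne' this
    have h6 : (K.card : ℝ) * q + L.card * p < p * q := by exact_mod_cast h1
    nlinarith
  · have hL' : ∀ l, b l = α⁻¹ := fun l => by
      by_contra h
      exact hL ⟨l, by simp [L, h]⟩
    -- Every row sum is positive, so each row meets the support and its `a k` is determined by `b`.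
    refine ⟨fun k => ?_, hL'⟩
    obtain ⟨l, -, hl⟩ := Finset.exists_ne_zero_of_sum_ne_zero (by rw [hrow k]; exact hqs.ne')
    have := hb k l hl
    rw [hL' l] at this
    exact (inv_injective this).symm

/-- A fixed point of both updates is a global minimum, unique up to rescaling. -/
theorem objective_le_of_fixed (hn : 0 < n) (hp : 0 < p) (hq : 0 < q)
    {Y : Fin n → Matrix (Fin p) (Fin q) ℝ} (hY : Stable Y) {P P' : Matrix (Fin p) (Fin p) ℝ}
    {Q Q' : Matrix (Fin q) (Fin q) ℝ} (hP : P.PosDef) (hQ : Q.PosDef) (hP' : P'.PosDef)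
    (hQ' : Q'.PosDef) (hPfix : P = rowUpdate Y Q) (hQfix : Q = rowUpdate (fun i => (Y i)ᵀ) P) :
    objective Y P Q ≤ objective Y P' Q' ∧
      (objective Y P' Q' ≤ objective Y P Q → ∃ c : ℝ, 0 < c ∧ P' = c • P ∧ Q' = c⁻¹ • Q) := by
  have hn' : (0 : ℝ) < n := by positivity
  have hp' : (0 : ℝ) < p := by positivity
  have hq' : (0 : ℝ) < q := by positivity
  obtain ⟨A, a, hA, hPA, hPA'⟩ := exists_simultaneous_diagonalization hP.inv hP'.inv.isHermitian
  obtain ⟨B, b, hB, hQB, hQB'⟩ := exists_simultaneous_diagonalization hQ.inv hQ'.inv.isHermitian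
  have ha : ∀ k, 0 < a k := (posDef_congr_diagonal_iff hA a).1 (hPA' ▸ hP'.inv)
  have hb : ∀ l, 0 < b l := (posDef_congr_diagonal_iff hB b).1 (hQB' ▸ hQ'.inv)
  have hAA : Aᵀ * P * A = 1 := by
    have h1 : P = (A * Aᵀ)⁻¹ := by
      rw [← hPA, nonsing_inv_nonsing_inv _ ((isUnit_iff_isUnit_det _).1 hP.isUnit)]
    rw [h1, Matrix.mul_inv_rev, ← Matrix.mul_assoc, mul_nonsing_inv _ (by rwa [det_transpose]),
      Matrix.one_mul, nonsing_inv_mul _ hA]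
  have hBB : Bᵀ * Q * B = 1 := by
    have h1 : Q = (B * Bᵀ)⁻¹ := by
      rw [← hQB, nonsing_inv_nonsing_inv _ ((isUnit_iff_isUnit_det _).1 hQ.isUnit)]
    rw [h1, Matrix.mul_inv_rev, ← Matrix.mul_assoc, mul_nonsing_inv _ (by rwa [det_transpose]),
      Matrix.one_mul, nonsing_inv_mul _ hB]
  -- After whitening by the fixed point, its two equations say that the sums of `W Wᵀ` and of `Wᵀ W`
  -- are multiples of the identity. Their diagonals give the constant row and column sums of `M`.
  set W := fun i => Aᵀ * Y i * B with hW
  set M : Fin p → Fin q → ℝ := fun k l => ∑ i, W i k l ^ 2 with hM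
  have hrowM : ∑ i, W i * (W i)ᵀ = ((q : ℝ) * n) • (1 : Matrix (Fin p) (Fin p) ℝ) := by
    calc ∑ i, W i * (W i)ᵀ = Aᵀ * (∑ i, Y i * Q⁻¹ * (Y i)ᵀ) * A := by
          rw [Finset.mul_sum, Finset.sum_mul, hQB]
          refine Finset.sum_congr rfl fun i _ => ?_
          simp only [hW, transpose_mul, transpose_transpose, Matrix.mul_assoc]
      _ = Aᵀ * (((q : ℝ) * n) • P) * A := by
          conv_rhs => rw [hPfix, rowUpdate, smul_smul, mul_one_div_cancel (by positivity), one_smul]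
      _ = ((q : ℝ) * n) • (1 : Matrix (Fin p) (Fin p) ℝ) := by
          rw [Matrix.mul_smul, Matrix.smul_mul, hAA]
  have hcolM : ∑ i, (W i)ᵀ * W i = ((p : ℝ) * n) • (1 : Matrix (Fin q) (Fin q) ℝ) := by
    calc ∑ i, (W i)ᵀ * W i = Bᵀ * (∑ i, (Y i)ᵀ * P⁻¹ * (Y i)ᵀᵀ) * B := by
          rw [Finset.mul_sum, Finset.sum_mul, hPA]
          refine Finset.sum_congr rfl fun i _ => ?_
          simp only [hW, transpose_mul, transpose_transpose, Matrix.mul_assoc]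
      _ = Bᵀ * (((p : ℝ) * n) • Q) * B := by
          conv_rhs => rw [hQfix, rowUpdate, smul_smul, mul_one_div_cancel (by positivity), one_smul]
      _ = ((p : ℝ) * n) • (1 : Matrix (Fin q) (Fin q) ℝ) := by
          rw [Matrix.mul_smul, Matrix.smul_mul, hBB]
  have hrow : ∀ k, ∑ l, M k l = q * n := fun k => by
    have := congrFun (congrFun hrowM k) k
    rw [Matrix.sum_apply, Matrix.smul_apply, one_apply_eq, smul_eq_mul, mul_one] at this
    rw [← this, hM, Finset.sum_comm]
    refine Finset.sum_congr rfl fun i _ => ?_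
    rw [mul_apply]
    exact Finset.sum_congr rfl fun l _ => by rw [transpose_apply, sq]
  have hcol : ∀ l, ∑ k, M k l = p * n := fun l => by
    have := congrFun (congrFun hcolM l) l
    rw [Matrix.sum_apply, Matrix.smul_apply, one_apply_eq, smul_eq_mul, mul_one] at this
    rw [← this, hM, Finset.sum_comm]
    refine Finset.sum_congr rfl fun i _ => ?_
    rw [mul_apply]
    exact Finset.sum_congr rfl fun k _ => by rw [transpose_apply, sq]
  have hMnn : ∀ k l, 0 ≤ M k l := fun k l => Finset.sum_nonneg fun i _ => sq_nonneg _
  have hobj : objective Y P Q =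
      (1 / (n : ℝ)) * ∑ k, ∑ l, M k l + (q * Real.log P.det + p * Real.log Q.det) := by
    unfold objective
    have := sum_trace_congr_diagonal Y A B (fun _ => 1) (fun _ => 1)
    simp only [diagonal_one, mul_one] at this
    rw [hPA, hQB, this]
  have hlogP : Real.log P'.det = Real.log P.det - ∑ k, Real.log (a k) := by
    have h1 := log_det_congr_diagonal hA ha
    rw [← hPA', ← hPA, det_nonsing_inv, det_nonsing_inv,
      Ring.inverse_eq_inv', Real.log_inv, Real.log_inv] at h1
    linarith
  have hlogQ : Real.log Q'.det = Real.log Q.det - ∑ l, Real.log (b l) := by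
    have h1 := log_det_congr_diagonal hB hb
    rw [← hQB', ← hQB, det_nonsing_inv, det_nonsing_inv,
      Ring.inverse_eq_inv', Real.log_inv, Real.log_inv] at h1
    linarith
  have hobj' : objective Y P' Q' = (1 / (n : ℝ)) * ∑ k, ∑ l, M k l * (a k * b l) +
      (q * Real.log P'.det + p * Real.log Q'.det) := by
    unfold objective
    rw [hPA', hQB', sum_trace_congr_diagonal Y A B a b]
  have hloga : ∑ k, ∑ l, M k l * Real.log (a k) = q * n * ∑ k, Real.log (a k) := by
    rw [Finset.mul_sum]
    exact Finset.sum_congr rfl fun k _ => by rw [← Finset.sum_mul, hrow]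
  have hlogb : ∑ k, ∑ l, M k l * Real.log (b l) = p * n * ∑ l, Real.log (b l) := by
    rw [Finset.mul_sum, Finset.sum_comm]
    exact Finset.sum_congr rfl fun k _ => by rw [← Finset.sum_mul, hcol]
  -- The constant row and column sums are what lets the log-determinants be absorbed entry by entry
  -- into the weights `M k l`.
  have hdiff : n * (objective Y P' Q' - objective Y P Q) =
      ∑ k, ∑ l, M k l * (a k * b l - 1 - Real.log (a k * b l)) := by
    have : ∀ k l, M k l * (a k * b l - 1 - Real.log (a k * b l)) =
        M k l * (a k * b l) - M k l - M k l * Real.log (a k) - M k l * Real.log (b l) :=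
      fun k l => by rw [Real.log_mul (ha k).ne' (hb l).ne']; ring
    simp_rw [this, Finset.sum_sub_distrib]
    rw [hloga, hlogb, hobj, hobj', hlogP, hlogQ]
    field_simp
    ring
  have hterm : ∀ k l, 0 ≤ M k l * (a k * b l - 1 - Real.log (a k * b l)) := fun k l => by
    have := Real.log_le_sub_one_of_pos (mul_pos (ha k) (hb l))
    exact mul_nonneg (hMnn k l) (by linarith)
  refine ⟨?_, fun hle => ?_⟩
  · have h1 : 0 ≤ n * (objective Y P' Q' - objective Y P Q) := by
      rw [hdiff]
      exact Finset.sum_nonneg fun k _ => Finset.sum_nonneg fun l _ => hterm k l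
    have := nonneg_of_mul_nonneg_right h1 hn'
    linarith
  · have h0 : ∑ k, ∑ l, M k l * (a k * b l - 1 - Real.log (a k * b l)) = 0 := by
      refine le_antisymm ?_
        (Finset.sum_nonneg fun k _ => Finset.sum_nonneg fun l _ => hterm k l)
      rw [← hdiff]
      exact mul_nonpos_of_nonneg_of_nonpos hn'.le (by linarith)
    have hab : ∀ k l, M k l ≠ 0 → a k * b l = 1 := fun k l hne => by
      rw [Finset.sum_eq_zero_iff_of_nonneg
        fun k _ => Finset.sum_nonneg fun l _ => hterm k l] at h0
      have h1 := h0 k (Finset.mem_univ k)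
      rw [Finset.sum_eq_zero_iff_of_nonneg fun l _ => hterm k l] at h1
      have h2 := (mul_eq_zero.1 (h1 l (Finset.mem_univ l))).resolve_left hne
      exact (log_le_sub_one_eq_iff (mul_pos (ha k) (hb l))).1 h2
    obtain ⟨c, hc, hac, hbc⟩ := eq_const_of_support hn' hp hq hrow hcol
      (fun K L hK hL h => hY.finset_card_lt hA hB hK hL fun i k hk l hl => by
        have := h k hk l hl
        rw [hM, Finset.sum_eq_zero_iff_of_nonneg fun i _ => sq_nonneg _] at this
        exact pow_eq_zero_iff two_ne_zero |>.1 (this i (Finset.mem_univ i))) ha hab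
    refine ⟨c⁻¹, inv_pos.2 hc, ?_, ?_⟩
    · have h1 : P'⁻¹ = c • P⁻¹ := by
        rw [hPA', hPA, show a = fun _ => c from funext hac, ← smul_one_eq_diagonal]
        simp
      rw [← nonsing_inv_nonsing_inv P' ((isUnit_iff_isUnit_det _).1 hP'.isUnit), h1,
        inv_smul_of_pos hc hP.inv,
        nonsing_inv_nonsing_inv _ ((isUnit_iff_isUnit_det _).1 hP.isUnit)]
    · have h1 : Q'⁻¹ = c⁻¹ • Q⁻¹ := by
        rw [hQB', hQB, show b = fun _ => c⁻¹ from funext hbc, ← smul_one_eq_diagonal]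
        simp
      rw [← nonsing_inv_nonsing_inv Q' ((isUnit_iff_isUnit_det _).1 hQ'.isUnit), h1,
        inv_smul_of_pos (inv_pos.2 hc) hQ.inv,
        nonsing_inv_nonsing_inv _ ((isUnit_iff_isUnit_det _).1 hQ.isUnit)]

end Objective

/-! ### Greedy selection of independent rows and summation by parts. -/

section Coercivity

open Matrix

theorem exists_sorted_orthogonal_diagonalization {d : ℕ} {H : Matrix (Fin d) (Fin d) ℝ}
    (hH : H.IsHermitian) :
    ∃ (O : Matrix (Fin d) (Fin d) ℝ) (v : Fin d → ℝ),
      Oᵀ * O = 1 ∧ Monotone v ∧ H = O * diagonal v * Oᵀ := by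
  obtain ⟨O, v, hO, -, h⟩ := exists_orthogonal_diagonalization hH
  refine ⟨O.submatrix id (Tuple.sort v), v ∘ Tuple.sort v, ?_, Tuple.monotone_sort v, ?_⟩
  · rw [transpose_submatrix, ← submatrix_mul _ _ _ id _ Function.bijective_id, hO,
      submatrix_one_equiv]
  · have h1 : diagonal (v ∘ Tuple.sort v) = (diagonal v).submatrix (Tuple.sort v) (Tuple.sort v) :=
      (submatrix_diagonal_equiv _ _).symm
    rw [h1, transpose_submatrix, submatrix_mul_equiv, submatrix_mul_equiv, submatrix_id_id, h]

/-- Along an increasing chain of index sets there is a linearly independent subfamily whose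
intersection with every member of the chain is spanning. -/
theorem exists_linearIndepOn_of_monotone {ι V : Type*} [AddCommGroup V] [Module ℝ V] (w : ι → V)
    {t : ℕ → Set ι} (ht : Monotone t) (N : ℕ) :
    ∃ B ⊆ t N, LinearIndepOn ℝ w B ∧
      ∀ k ≤ N, w '' t k ⊆ Submodule.span ℝ (w '' (B ∩ t k)) := by
  induction N with
  | zero =>
    have h0 : LinearIndepOn ℝ w (∅ : Set ι) := linearIndepOn_empty ℝ w
    have hsub := h0.extend_subset (Set.empty_subset (t 0))
    refine ⟨h0.extend (Set.empty_subset (t 0)), hsub, h0.linearIndepOn_extend _, fun k hk => ?_⟩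
    obtain rfl := Nat.le_zero.1 hk
    rw [Set.inter_eq_left.2 hsub]
    exact h0.image_subset_span_image_extend _
  | succ N ih =>
    obtain ⟨B, hB, hind, hspan⟩ := ih
    have hBt : B ⊆ t (N + 1) := hB.trans (ht N.le_succ)
    have hsub := hind.extend_subset hBt
    refine ⟨hind.extend hBt, hsub, hind.linearIndepOn_extend _, fun k hk => ?_⟩
    rcases Nat.le_succ_iff.1 hk with hk | rfl
    · refine (hspan k hk).trans (Submodule.span_mono (Set.image_mono ?_))
      exact Set.inter_subset_inter_left _ (hind.subset_extend hBt)
    · rw [Set.inter_eq_left.2 hsub]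
      exact hind.image_subset_span_image_extend _

/-- Summation by parts for a decreasing sequence sampled along `κ`. -/
theorem sub_le_mul_sum_sub_mul_sum {N q : ℕ} {f : ℕ → ℝ} (hf : ∀ j < N, f (j + 1) ≤ f j)
    (κ : Fin q → Fin (N + 1))
    (hκ : ∀ k, 0 < k → k < N + 1 →
      k * q < (N + 1) * (Finset.univ.filter fun a => (κ a : ℕ) < k).card) :
    f 0 - f N ≤ (N + 1 : ℕ) * ∑ a, f (κ a) - q * ∑ k : Fin (N + 1), f k := by
  -- Each value is `f N` plus the later gaps. After exchanging sums the multiples of `f N` cancel,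
  -- and the gap at `j` has coefficient `(N + 1) * #{a | κ a < j + 1} - q * (j + 1)`, a positive
  -- integer by `hκ`, hence at least one.
  have hrep : ∀ k : Fin (N + 1), f k =
      f N + ∑ j ∈ Finset.range N, if (k : ℕ) < j + 1 then f j - f (j + 1) else 0 := fun k => by
    have hk : (k : ℕ) ≤ N := Nat.lt_succ_iff.1 k.2
    have h1 : ∑ j ∈ Finset.range N, (if (k : ℕ) < j + 1 then f j - f (j + 1) else 0) =
        ∑ j ∈ Finset.Ico (k : ℕ) N, (f j - f (j + 1)) := by
      rw [← Finset.sum_filter]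
      refine Finset.sum_congr ?_ fun _ _ => rfl
      ext j
      simp [and_comm]
    rw [h1, Finset.sum_Ico_eq_sum_range]
    have h2 := Finset.sum_range_sub' (fun i => f (k + i)) (N - k)
    simp only [← add_assoc] at h2
    rw [h2, Nat.add_sub_of_le hk]
    simp
  have hsumκ : ∑ a, f (κ a) = q * f N + ∑ j ∈ Finset.range N,
      (Finset.univ.filter fun a => (κ a : ℕ) < j + 1).card * (f j - f (j + 1)) := by
    simp_rw [hrep, Finset.sum_add_distrib]
    rw [Finset.sum_comm]
    simp only [← Finset.sum_filter, Finset.sum_const, nsmul_eq_mul, Finset.card_univ,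
      Fintype.card_fin]
  have hsum : ∑ k : Fin (N + 1), f k = (N + 1 : ℕ) * f N + ∑ j ∈ Finset.range N,
      (j + 1 : ℕ) * (f j - f (j + 1)) := by
    rw [Finset.sum_congr rfl fun k _ => hrep k, Finset.sum_add_distrib, Finset.sum_comm]
    congr 1
    · simp
    · refine Finset.sum_congr rfl fun j hj => ?_
      rw [← Finset.sum_filter, Finset.sum_const, nsmul_eq_mul]
      congr 2
      have hj' := Finset.mem_range.1 hj
      have := Fin.card_filter_val_lt (n := N + 1) (m := j + 1)
      simpa [hj'.le] using this
  have htel : f 0 - f N = ∑ j ∈ Finset.range N, (f j - f (j + 1)) :=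
    (Finset.sum_range_sub' f N).symm
  rw [hsumκ, hsum, htel, mul_add, mul_add, Finset.mul_sum, Finset.mul_sum]
  have : ∑ j ∈ Finset.range N, (f j - f (j + 1)) ≤ ∑ j ∈ Finset.range N,
      (((N + 1 : ℕ) : ℝ) * ((Finset.univ.filter fun a => (κ a : ℕ) < j + 1).card
        * (f j - f (j + 1))) - q * ((j + 1 : ℕ) * (f j - f (j + 1)))) := by
    refine Finset.sum_le_sum fun j hj => ?_
    have hj' := Finset.mem_range.1 hj
    have h1 := hκ (j + 1) j.succ_pos (by omega)
    have h2 : (((j + 1 : ℕ) : ℝ)) * q + 1 ≤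
        ((N + 1 : ℕ) : ℝ) * (Finset.univ.filter fun a => (κ a : ℕ) < j + 1).card := by
      exact_mod_cast h1
    have h3 := hf j hj'
    nlinarith
  refine this.trans (le_of_eq ?_)
  rw [Finset.sum_sub_distrib]
  ring

variable {n p q : ℕ}

/-- The `q × q` matrix made of the rows `J a` of the matrices `Oᵀ * Y i`. -/
noncomputable def rowSelection (Y : Fin n → Matrix (Fin p) (Fin q) ℝ) (J : Fin q → Fin n × Fin p)
    (O : Matrix (Fin p) (Fin p) ℝ) : Matrix (Fin q) (Fin q) ℝ :=
  Matrix.of fun a => (Oᵀ * Y (J a).1) (J a).2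

/-- Rows are chosen greedily, those of small index first. The chosen rows of index below `k` span
all such rows, so vectors orthogonal to them form a zero block against the first `k` columns of `O`;
stability bounds the dimension of that space and thus forces many rows to be chosen. -/
theorem Stable.exists_rowSelection (hp : 0 < p) (hq : 0 < q)
    {Y : Fin n → Matrix (Fin p) (Fin q) ℝ} (hY : Stable Y) {O : Matrix (Fin p) (Fin p) ℝ}
    (hO : IsUnit O.det) :
    ∃ J : Fin q → Fin n × Fin p, (rowSelection Y J O).det ≠ 0 ∧
      ∀ k, 0 < k → k < p →
        k * q < p * (Finset.univ.filter fun a => ((J a).2 : ℕ) < k).card := by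
  classical
  set w : Fin n × Fin p → Fin q → ℝ := fun x => (Oᵀ * Y x.1) x.2 with hw
  let t : ℕ → Set (Fin n × Fin p) := fun k => {x | (x.2 : ℕ) < k}
  have ht : Monotone t := fun k k' h x hx => lt_of_lt_of_le hx h
  obtain ⟨B, -, hind, hspan⟩ := exists_linearIndepOn_of_monotone w ht p
  -- The second alternative covers a trivial orthogonal complement, to which stability does not
  -- apply. At `k = p` it yields that `B` has `q` elements.
  have hcount : ∀ k, 0 < k → k ≤ p → k * q < p * (B ∩ t k).ncard ∨ q ≤ (B ∩ t k).ncard := by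
    intro k hk hkp
    by_contra! hcon
    obtain ⟨hcon, hlt⟩ := hcon
    let R : Matrix (B ∩ t k : Set (Fin n × Fin p)) (Fin q) ℝ := Matrix.of fun x => w x
    let ker := LinearMap.ker R.mulVecLin
    have hdim : q ≤ Module.finrank ℝ ker + (B ∩ t k).ncard := by
      have h1 : Module.finrank ℝ (LinearMap.range R.mulVecLin) + Module.finrank ℝ ker = _ :=
        LinearMap.finrank_range_add_finrank_ker R.mulVecLin
      have h2 : Module.finrank ℝ (LinearMap.range R.mulVecLin) ≤ (B ∩ t k).ncard := by
        have := R.rank_le_card_height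
        rwa [← Nat.card_eq_fintype_card] at this
      rw [Module.finrank_fin_fun] at h1
      omega
    have hfr : 0 < Module.finrank ℝ ker := by omega
    have hv : LinearIndependent ℝ (Subtype.val ∘ Module.finBasis ℝ ker) :=
      (Module.finBasis ℝ ker).linearIndependent.map' ker.subtype ker.ker_subtype
    have hu : LinearIndependent ℝ (Oᵀ.row ∘ Fin.castLE hkp) :=
      (linearIndependent_transpose_of_isUnit_det hO).comp _ (Fin.castLE_injective hkp)
    have horth : ∀ x ∈ t k, ∀ y ∈ ker, w x ⬝ᵥ y = 0 := by
      intro x hx y hy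
      have hmem := hspan k hkp (Set.mem_image_of_mem w hx)
      refine Submodule.span_induction (p := fun z _ => z ⬝ᵥ y = 0) ?_ ?_ ?_ ?_ hmem
      · rintro _ ⟨x', hx', rfl⟩
        exact congrFun (LinearMap.mem_ker.1 hy) ⟨x', hx'⟩
      · simp
      · intro z z' _ _ hz hz'
        rw [add_dotProduct, hz, hz', add_zero]
      · intro c z _ hz
        rw [smul_dotProduct, hz, smul_zero]
    have := hY k _ _ _ hu hv hk hfr fun i k' l => by
      have h1 := horth (i, Fin.castLE hkp k') k'.2 _ (Module.finBasis ℝ ker l).2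
      rw [← h1, dotProduct_mulVec]
      rfl
    have h2 : p * q ≤ p * (Module.finrank ℝ ker + (B ∩ t k).ncard) := Nat.mul_le_mul_left _ hdim
    rw [mul_add, mul_comm p (Module.finrank _ _)] at h2
    omega
  have htp : t p = Set.univ := by
    ext x
    simp [t]
  have hcardB : Fintype.card B = q := by
    refine le_antisymm ?_ ?_
    · have := LinearIndependent.fintype_card_le_finrank hind
      rwa [Module.finrank_fin_fun] at this
    · have := hcount p hp le_rfl
      rw [htp, Set.inter_univ, ← Nat.card_coe_set_eq, Nat.card_eq_fintype_card] at this
      rcases this with h | h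
      · exact (Nat.lt_of_mul_lt_mul_left h).le
      · exact h
  let e : Fin q ≃ B := (Fintype.equivFinOfCardEq hcardB).symm
  refine ⟨fun a => e a, ?_, fun k hk hkp => ?_⟩
  · have : LinearIndependent ℝ (rowSelection Y (fun a => e a) O).row :=
      LinearIndependent.comp hind e e.injective
    rw [linearIndependent_rows_iff_isUnit, isUnit_iff_isUnit_det] at this
    exact this.ne_zero
  · have hcard : (Finset.univ.filter fun a => ((e a : Fin n × Fin p).2 : ℕ) < k).card =
        (B ∩ t k).ncard := by
      rw [← Set.ncard_coe_finset]
      refine Set.ncard_congr (fun a _ => (e a : Fin n × Fin p)) ?_ ?_ ?_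
      · intro a ha
        exact ⟨(e a).2, (Finset.mem_filter.1 (Finset.mem_coe.1 ha)).2⟩
      · intro a b _ _ h
        exact e.injective (Subtype.ext h)
      · rintro x ⟨hx, hxk⟩
        exact ⟨e.symm ⟨x, hx⟩, Finset.mem_coe.2 (Finset.mem_filter.2 ⟨Finset.mem_univ _, by
          rw [e.apply_symm_apply]; exact hxk⟩),
          by simp⟩
    rw [hcard]
    rcases hcount k hk hkp.le with h | h
    · exact h
    · exact lt_of_lt_of_le (Nat.mul_lt_mul_of_pos_right hkp hq) (Nat.mul_le_mul_left p h)

end Coercivity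

/-! ### Coercivity of the profile. -/

section CoerciveBound

open Matrix

variable {n p q : ℕ}

theorem isCompact_orthogonal (d : ℕ) :
    IsCompact {O : Matrix (Fin d) (Fin d) ℝ | Oᵀ * O = 1} := by
  refine (isCompact_specNorm_le 1).of_isClosed_subset ?_ ?_
  · exact isClosed_eq (by fun_prop) continuous_const
  · intro O hO
    have hO' : O * Oᵀ = 1 := mul_eq_one_comm.1 hO
    have h1 := specNorm_orthogonal_conj_le (O := 1) (d := d) (by simp) (v := fun _ => 1)
      zero_le_one (by simp)
    simp only [diagonal_one, transpose_one, Matrix.mul_one] at h1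
    have h2 : specNorm O * specNorm O ≤ 1 := by
      have h3 := l2_opNorm_conjTranspose_mul_self O
      rw [conjTranspose_eq_transpose_of_trivial, show Oᵀ * O = 1 from hO] at h3
      exact h3.symm.trans_le h1
    have h4 : 0 ≤ specNorm O := norm_nonneg _
    show specNorm O ≤ 1
    nlinarith

theorem isUnit_det_of_transpose_mul_self {d : ℕ} {O : Matrix (Fin d) (Fin d) ℝ}
    (hO : Oᵀ * O = 1) : IsUnit O.det := by
  have := congrArg det hO
  rw [det_mul, det_one] at this
  exact IsUnit.of_mul_eq_one _ (by rw [mul_comm]; exact this)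

/-- The selection depends on `O`, but the sum of squared determinants over all admissible selections
is continuous and positive on the compact orthogonal group. Its minimum, divided by the number of
selections, bounds some single term from below. -/
theorem Stable.exists_uniform_rowSelection (hp : 0 < p) (hq : 0 < q)
    {Y : Fin n → Matrix (Fin p) (Fin q) ℝ} (hY : Stable Y) :
    ∃ c : ℝ, 0 < c ∧ ∀ O : Matrix (Fin p) (Fin p) ℝ, Oᵀ * O = 1 →
      ∃ J : Fin q → Fin n × Fin p, c ≤ (rowSelection Y J O).det ^ 2 ∧
        ∀ k, 0 < k → k < p →
          k * q < p * (Finset.univ.filter fun a => ((J a).2 : ℕ) < k).card := by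
  classical
  let good : Finset (Fin q → Fin n × Fin p) := Finset.univ.filter fun J =>
    ∀ k, 0 < k → k < p → k * q < p * (Finset.univ.filter fun a => ((J a).2 : ℕ) < k).card
  let F : Matrix (Fin p) (Fin p) ℝ → ℝ := fun O => ∑ J ∈ good, (rowSelection Y J O).det ^ 2
  have hF : Continuous F := by
    refine continuous_finsetSum _ fun J _ => (Continuous.matrix_det ?_).pow 2
    refine continuous_matrix fun a b => ?_
    have : Continuous fun O : Matrix (Fin p) (Fin p) ℝ => Oᵀ * Y (J a).1 := by fun_prop
    exact this.matrix_elem _ _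
  have hpos : ∀ O : Matrix (Fin p) (Fin p) ℝ, Oᵀ * O = 1 → 0 < F O := fun O hO => by
    obtain ⟨J, hJ, hJ'⟩ := hY.exists_rowSelection hp hq (isUnit_det_of_transpose_mul_self hO)
    exact Finset.sum_pos' (fun _ _ => sq_nonneg _)
      ⟨J, Finset.mem_filter.2 ⟨Finset.mem_univ _, hJ'⟩, by positivity⟩
  have hone : (1 : Matrix (Fin p) (Fin p) ℝ)ᵀ * 1 = 1 := by simp
  obtain ⟨O₀, hO₀, hmin⟩ := (isCompact_orthogonal p).exists_isMinOn ⟨1, hone⟩ hF.continuousOn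
  have hne : good.Nonempty := by
    by_contra h
    have := hpos 1 hone
    simp [F, Finset.not_nonempty_iff_eq_empty.1 h] at this
  have hcard : (0 : ℝ) < good.card := by exact_mod_cast hne.card_pos
  refine ⟨F O₀ / good.card, div_pos (hpos O₀ hO₀) hcard, fun O hO => ?_⟩
  obtain ⟨J, hJ, hle⟩ := Finset.exists_le_of_sum_le (s := good) (f := fun _ => F O₀ / good.card)
    (g := fun J => (rowSelection Y J O).det ^ 2) hne (by
      rw [Finset.sum_const, nsmul_eq_mul, mul_div_cancel₀ _ hcard.ne']
      exact hmin hO)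
  exact ⟨J, hle, (Finset.mem_filter.1 hJ).2⟩

theorem transpose_mul_diagonal_mul {m k : Type*} [Fintype m] [DecidableEq m]
    (W : Matrix m k ℝ) (v : m → ℝ) :
    Wᵀ * diagonal v * W = ∑ a, v a • vecMulVec (W a) (W a) := by
  ext i j
  rw [mul_apply, Matrix.sum_apply]
  refine Finset.sum_congr rfl fun a _ => ?_
  rw [mul_diagonal, transpose_apply, Matrix.smul_apply, vecMulVec_apply, smul_eq_mul]
  ring

/-- The right-hand matrix is a sum of weighted rank-one terms, one for each row of the rotated
samples; discarding the unselected rows can only lower the determinant. -/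
theorem det_rowSelection_le {Y : Fin n → Matrix (Fin p) (Fin q) ℝ}
    {J : Fin q → Fin n × Fin p} {O : Matrix (Fin p) (Fin p) ℝ}
    (hJ : (rowSelection Y J O).det ≠ 0) {v : Fin p → ℝ} (hv : ∀ k, 0 < v k) :
    (rowSelection Y J O).det ^ 2 * ∏ a, v (J a).2 ≤
      (∑ i, (Y i)ᵀ * (O * diagonal v * Oᵀ) * Y i).det := by
  classical
  set w : Fin n × Fin p → Fin q → ℝ := fun x => (Oᵀ * Y x.1) x.2 with hw
  have hJinj : Function.Injective J := fun a b hab => by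
    by_contra hne
    exact hJ (det_zero_of_row_eq hne (by ext l; simp [rowSelection, hab]))
  have hsum : ∑ i, (Y i)ᵀ * (O * diagonal v * Oᵀ) * Y i =
      ∑ x : Fin n × Fin p, v x.2 • vecMulVec (w x) (w x) := by
    rw [Fintype.sum_prod_type]
    refine Finset.sum_congr rfl fun i _ => ?_
    rw [← transpose_mul_diagonal_mul (Oᵀ * Y i) v]
    simp only [transpose_mul, transpose_transpose, Matrix.mul_assoc]
  have hsel : ∑ x ∈ Finset.univ.image J, v x.2 • vecMulVec (w x) (w x) =
      (rowSelection Y J O)ᵀ * diagonal (fun a => v (J a).2) * (rowSelection Y J O)ᵀᵀ := by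
    rw [Finset.sum_image fun a _ b _ h => hJinj h, transpose_transpose,
      transpose_mul_diagonal_mul]
    rfl
  rw [hsum, ← Finset.sum_add_sum_compl (Finset.univ.image J), hsel]
  have hunit : IsUnit ((rowSelection Y J O)ᵀ).det := by
    rw [det_transpose]
    exact isUnit_iff_ne_zero.2 hJ
  refine le_trans (le_of_eq ?_) (PosDef.det_le_det_add
    ((posDef_congr_diagonal_iff hunit _).2 fun a => hv _) ?_).1
  · rw [det_congr_diagonal, det_mul, transpose_transpose, det_transpose, sq]
  · refine posSemidef_sum _ fun x _ => PosSemidef.smul ?_ (hv _).le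
    simpa using posSemidef_vecMulVec_self_star (w x)

/-- The objective, minimized over the column covariance. -/
noncomputable def profile (Y : Fin n → Matrix (Fin p) (Fin q) ℝ) (P : Matrix (Fin p) (Fin p) ℝ) :
    ℝ :=
  objective Y P (rowUpdate (fun i => (Y i)ᵀ) P)

theorem profile_eq (hn : 0 < n) (hp : 0 < p) {Y : Fin n → Matrix (Fin p) (Fin q) ℝ}
    (hY : Stable Y) {P : Matrix (Fin p) (Fin p) ℝ} (hP : P.PosDef) :
    profile Y P = p * (q + Real.log (rowUpdate (fun i => (Y i)ᵀ) P).det) +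
      q * Real.log P.det := by
  have hU := rowUpdate_posDef hn hp hY.transpose hP
  rw [profile, ← objective_transpose, objective_eq hn hp,
    nonsing_inv_mul _ ((isUnit_iff_isUnit_det _).1 hU.isUnit), trace_one, Fintype.card_fin]

/-- Bounds the smallest eigenvalue of `P` below in terms of the profile: the selected rows give
`profile Y P ≥ c - log μ_min + log μ_max`, and `μ_max ≥ 1`. -/
theorem Stable.exists_profile_coercive (hn : 0 < n) (hp : 0 < p) (hq : 0 < q)
    {Y : Fin n → Matrix (Fin p) (Fin q) ℝ} (hY : Stable Y) :
    ∃ c : ℝ, ∀ P : Matrix (Fin p) (Fin p) ℝ, P.PosDef → specNorm P = 1 →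
      (P - Real.exp (c - profile Y P) • (1 : Matrix (Fin p) (Fin p) ℝ)).PosSemidef := by
  obtain ⟨c, hc, hsel⟩ := hY.exists_uniform_rowSelection hp hq
  have hpn : (0 : ℝ) < 1 / ((p : ℝ) * n) := by positivity
  refine ⟨p * (q + (q * Real.log (1 / ((p : ℝ) * n)) + Real.log c)), fun P hP hnorm => ?_⟩
  obtain ⟨O, μ, hO, hmono, hPO⟩ := exists_sorted_orthogonal_diagonalization hP.isHermitian
  have hO' : O * Oᵀ = 1 := mul_eq_one_comm.1 hO
  have hOu := isUnit_det_of_transpose_mul_self hO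
  have hμ : ∀ k, 0 < μ k := (posDef_congr_diagonal_iff hOu μ).1 (hPO ▸ hP)
  have hPinv : P⁻¹ = O * diagonal (fun k => (μ k)⁻¹) * Oᵀ := by
    refine inv_eq_right_inv ?_
    rw [hPO]
    calc O * diagonal μ * Oᵀ * (O * diagonal (fun k => (μ k)⁻¹) * Oᵀ) =
          O * (diagonal μ * (Oᵀ * O) * diagonal (fun k => (μ k)⁻¹)) * Oᵀ := by
            simp only [Matrix.mul_assoc]
      _ = 1 := by
        rw [hO, Matrix.mul_one, diagonal_mul_diagonal]
        simp [(hμ _).ne', hO']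
  obtain ⟨J, hJc, hJ⟩ := hsel O hO
  have hJdet : (rowSelection Y J O).det ≠ 0 := fun h => by
    rw [h] at hJc
    norm_num at hJc
    linarith
  have hdet := det_rowSelection_le hJdet (v := fun k => (μ k)⁻¹) fun k => inv_pos.2 (hμ k)
  rw [← hPinv] at hdet
  have hprod : 0 < ∏ a, (μ (J a).2)⁻¹ := Finset.prod_pos fun a _ => inv_pos.2 (hμ _)
  have hlogU : q * Real.log (1 / ((p : ℝ) * n)) + Real.log c + ∑ a, Real.log ((μ (J a).2)⁻¹) ≤
      Real.log (rowUpdate (fun i => (Y i)ᵀ) P).det := by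
    have h1 : c * ∏ a, (μ (J a).2)⁻¹ ≤ (∑ i, (Y i)ᵀ * P⁻¹ * Y i).det :=
      (mul_le_mul_of_nonneg_right hJc hprod.le).trans hdet
    have h2 := Real.log_le_log (mul_pos hc hprod) h1
    rw [Real.log_mul hc.ne' hprod.ne', Real.log_prod fun a _ => (inv_pos.2 (hμ _)).ne'] at h2
    have h3 : 0 < (∑ i, (Y i)ᵀ * P⁻¹ * Y i).det := (mul_pos hc hprod).trans_le h1
    rw [rowUpdate, det_smul, Fintype.card_fin]
    simp only [transpose_transpose]
    rw [Real.log_mul (by positivity) h3.ne', Real.log_pow]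
    linarith
  have hlogP : Real.log P.det = ∑ k, Real.log (μ k) := by
    have := log_det_congr_diagonal hOu hμ
    rw [← hPO, hO', det_one, Real.log_one, zero_add] at this
    exact this
  obtain ⟨N, rfl⟩ : ∃ N, p = N + 1 := ⟨p - 1, by omega⟩
  -- The sequence is `-log μ`, decreasing because the eigenvalues are sorted increasingly; its value
  -- `0` past the last index is never used.
  have habel := sub_le_mul_sum_sub_mul_sum (N := N)
    (f := fun j => if h : j < N + 1 then -Real.log (μ ⟨j, h⟩) else 0)
    (fun j hj => by
      have h1 : j < N + 1 := by omega
      have h2 : j + 1 < N + 1 := by omega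
      simp only [h1, h2, dif_pos]
      refine neg_le_neg (Real.log_le_log (hμ _) (hmono ?_))
      simp) (fun a => (J a).2) hJ
  simp only [Fin.is_lt, dif_pos, Fin.eta, N.succ_pos, lt_add_iff_pos_right, zero_lt_one,
    Finset.sum_neg_distrib] at habel
  have hprof := profile_eq hn hp hY hP
  have hmax : 0 ≤ Real.log (μ ⟨N, N.lt_succ_self⟩) := by
    refine Real.log_nonneg ?_
    rw [← hnorm, hPO]
    refine specNorm_orthogonal_conj_le hO (hμ _).le fun i => ?_
    rw [abs_of_pos (hμ i)]
    exact hmono (Nat.lt_succ_iff.1 i.2)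
  have hmin : ((N + 1 : ℕ) : ℝ) * (q + (q * Real.log (1 / (((N + 1 : ℕ) : ℝ) * n)) + Real.log c)) -
      profile Y P ≤ Real.log (μ ⟨0, N.succ_pos⟩) := by
    have h1 : ((N + 1 : ℕ) : ℝ) * _ ≤ ((N + 1 : ℕ) : ℝ) * _ :=
      mul_le_mul_of_nonneg_left hlogU (by positivity)
    simp only [Real.log_inv, Finset.sum_neg_distrib] at h1
    rw [hprof, hlogP]
    linarith
  have hfin : P - Real.exp (((N + 1 : ℕ) : ℝ) *
      (q + (q * Real.log (1 / (((N + 1 : ℕ) : ℝ) * n)) + Real.log c)) - profile Y P) •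
        (1 : Matrix (Fin (N + 1)) (Fin (N + 1)) ℝ) =
      O * diagonal (fun k => μ k - Real.exp (((N + 1 : ℕ) : ℝ) *
      (q + (q * Real.log (1 / (((N + 1 : ℕ) : ℝ) * n)) + Real.log c)) - profile Y P)) * Oᵀ := by
    rw [← diagonal_sub, Matrix.mul_sub, Matrix.sub_mul, ← hPO, ← smul_one_eq_diagonal]
    simp [hO']
  rw [hfin]
  refine (posSemidef_congr_diagonal_iff hOu _).2 fun k => sub_nonneg.2 ?_
  refine le_trans ?_ (hmono (Fin.zero_le k))
  exact (Real.le_log_iff_exp_le (hμ _)).1 hmin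

end CoerciveBound

/-! ### Compact sublevel sets, existence of the fixed point, and convergence of the double step. -/

section FlipFlop

open Matrix

variable {n p q : ℕ}

theorem continuousOn_inv_posDef (d : ℕ) :
    ContinuousOn (fun A : Matrix (Fin d) (Fin d) ℝ => A⁻¹) {A | A.PosDef} := by
  intro A hA
  refine (continuousAt_matrix_inv A ?_).continuousWithinAt
  rw [Ring.inverse_eq_inv']
  exact continuousAt_inv₀ (Matrix.PosDef.det_pos hA).ne'

theorem continuousOn_rowUpdate (Y : Fin n → Matrix (Fin p) (Fin q) ℝ) :
    ContinuousOn (rowUpdate Y) {Q | Q.PosDef} := by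
  have h : Continuous fun S : Matrix (Fin q) (Fin q) ℝ =>
      (1 / ((q : ℝ) * n)) • ∑ i, Y i * S * (Y i)ᵀ := by fun_prop
  exact h.comp_continuousOn (continuousOn_inv_posDef q)

theorem continuousOn_profile (hn : 0 < n) (hp : 0 < p)
    {Y : Fin n → Matrix (Fin p) (Fin q) ℝ} (hY : Stable Y) :
    ContinuousOn (profile Y) {P | P.PosDef} := by
  have hdet : ∀ d : ℕ, Continuous fun A : Matrix (Fin d) (Fin d) ℝ => A.det :=
    fun d => continuous_id.matrix_det
  have h1 : ContinuousOn (fun P => Real.log (rowUpdate (fun i => (Y i)ᵀ) P).det)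
      {P : Matrix (Fin p) (Fin p) ℝ | P.PosDef} :=
    ((hdet q).comp_continuousOn (continuousOn_rowUpdate _)).log fun P hP =>
      (rowUpdate_posDef hn hp hY.transpose hP).det_pos.ne'
  have h2 : ContinuousOn (fun P => Real.log P.det)
      {P : Matrix (Fin p) (Fin p) ℝ | P.PosDef} :=
    (hdet p).continuousOn.log fun P hP => (Matrix.PosDef.det_pos hP).ne'
  refine ContinuousOn.congr (f := fun P => p * (q + Real.log (rowUpdate (fun i => (Y i)ᵀ) P).det) +
      q * Real.log P.det) ?_ fun P hP => profile_eq hn hp hY hP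
  exact (continuousOn_const.mul (continuousOn_const.add h1)).add (continuousOn_const.mul h2)

theorem isClosed_posSemidef (d : ℕ) :
    IsClosed {A : Matrix (Fin d) (Fin d) ℝ | A.PosSemidef} := by
  simp only [posSemidef_iff_dotProduct_mulVec, Set.ofPred_and, Set.ofPred_forall, IsHermitian]
  refine IsClosed.inter (isClosed_eq (by fun_prop) continuous_id) (isClosed_iInter fun x => ?_)
  exact isClosed_le continuous_const (by fun_prop)

/-- Coercivity gives `P ≥ ε • 1` on the sublevel set, which keeps it away from the singular matrices
where the profile is not continuous. -/
theorem isCompact_profile_le (hn : 0 < n) (hp : 0 < p) (hq : 0 < q)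
    {Y : Fin n → Matrix (Fin p) (Fin q) ℝ} (hY : Stable Y) (c : ℝ) :
    IsCompact {P : Matrix (Fin p) (Fin p) ℝ | P.PosDef ∧ specNorm P = 1 ∧ profile Y P ≤ c} := by
  obtain ⟨c₀, hc₀⟩ := hY.exists_profile_coercive hn hp hq
  set ε := Real.exp (c₀ - c) with hε
  have hεpos : 0 < ε := Real.exp_pos _
  let S : Set (Matrix (Fin p) (Fin p) ℝ) :=
    {P | (P - ε • (1 : Matrix (Fin p) (Fin p) ℝ)).PosSemidef ∧ specNorm P = 1}
  have hSclosed : IsClosed S := by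
    refine IsClosed.inter ?_ (isClosed_eq continuous_specNorm continuous_const)
    exact (isClosed_posSemidef p).preimage (continuous_id.sub continuous_const)
  have hScompact : IsCompact S :=
    (isCompact_specNorm_le 1).of_isClosed_subset hSclosed fun P hP => hP.2.le
  have hSpos : ∀ P ∈ S, P.PosDef := fun P hP => by
    have := (PosDef.one.smul hεpos : (ε • (1 : Matrix (Fin p) (Fin p) ℝ)).PosDef).add_posSemidef
      hP.1
    simpa using this
  have heq : {P : Matrix (Fin p) (Fin p) ℝ | P.PosDef ∧ specNorm P = 1 ∧ profile Y P ≤ c} =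
      S ∩ profile Y ⁻¹' Set.Iic c := by
    ext P
    constructor
    · rintro ⟨hP, hnorm, hle⟩
      refine ⟨⟨?_, hnorm⟩, hle⟩
      have h1 : 0 ≤ Real.exp (c₀ - profile Y P) - ε := by
        rw [hε, sub_nonneg, Real.exp_le_exp]
        linarith
      have h2 := (hc₀ P hP hnorm).add
        ((PosSemidef.one : (1 : Matrix (Fin p) (Fin p) ℝ).PosSemidef).smul h1)
      rw [sub_smul] at h2
      simpa using h2
    · rintro ⟨hP, hle⟩
      exact ⟨hSpos P hP, hP.2, hle⟩
  rw [heq]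
  exact hScompact.of_isClosed_subset
    (((continuousOn_profile hn hp hY).mono hSpos).preimage_isClosed_of_isClosed hSclosed
      isClosed_Iic) Set.inter_subset_left

/-- The multiple of `A` of spectral norm one. -/
noncomputable def normalize {d : ℕ} (A : Matrix (Fin d) (Fin d) ℝ) : Matrix (Fin d) (Fin d) ℝ :=
  (specNorm A)⁻¹ • A

theorem normalize_posDef {d : ℕ} (hd : 0 < d) {A : Matrix (Fin d) (Fin d) ℝ} (hA : A.PosDef) :
    (normalize A).PosDef :=
  hA.smul (inv_pos.2 (specNorm_pos_of_posDef hd hA))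

theorem specNorm_normalize {d : ℕ} (hd : 0 < d) {A : Matrix (Fin d) (Fin d) ℝ} (hA : A.PosDef) :
    specNorm (normalize A) = 1 := by
  have := specNorm_pos_of_posDef hd hA
  rw [normalize, specNorm_smul_of_nonneg (inv_pos.2 this).le, inv_mul_cancel₀ this.ne']

theorem normalize_smul {d : ℕ} {c : ℝ} (hc : 0 < c) (A : Matrix (Fin d) (Fin d) ℝ) :
    normalize (c • A) = normalize A := by
  rw [normalize, specNorm_smul_of_nonneg hc.le, smul_smul, mul_inv, mul_assoc, mul_comm,
    mul_assoc, mul_inv_cancel₀ hc.ne', mul_one, normalize]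

theorem continuousOn_normalize {d : ℕ} (hd : 0 < d) :
    ContinuousOn (normalize (d := d)) {A | A.PosDef} :=
  ContinuousOn.smul (continuous_specNorm.continuousOn.inv₀
    fun _ hA => (specNorm_pos_of_posDef hd hA).ne') continuousOn_id

theorem profile_smul (hn : 0 < n) (hp : 0 < p) {Y : Fin n → Matrix (Fin p) (Fin q) ℝ}
    (hY : Stable Y) {c : ℝ} (hc : 0 < c) {P : Matrix (Fin p) (Fin p) ℝ} (hP : P.PosDef) :
    profile Y (c • P) = profile Y P := by
  rw [profile, rowUpdate_smul hc hP, objective_smul hc hP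
    (rowUpdate_posDef hn hp hY.transpose hP), profile]

theorem profile_le_objective (hn : 0 < n) (hp : 0 < p) {Y : Fin n → Matrix (Fin p) (Fin q) ℝ}
    (hY : Stable Y) {P : Matrix (Fin p) (Fin p) ℝ} {Q : Matrix (Fin q) (Fin q) ℝ}
    (hP : P.PosDef) (hQ : Q.PosDef) : profile Y P ≤ objective Y P Q := by
  rw [profile, ← objective_transpose Y, ← objective_transpose Y]
  exact (objective_rowUpdate_le hn hp hY.transpose hQ hP).1

/-- Two successive steps of the flip-flop iteration act on the first factor as this map. -/
noncomputable def doubleStep (Y : Fin n → Matrix (Fin p) (Fin q) ℝ)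
    (P : Matrix (Fin p) (Fin p) ℝ) : Matrix (Fin p) (Fin p) ℝ :=
  normalize (rowUpdate Y (rowUpdate (fun i => (Y i)ᵀ) P))

/-- The double step is one round of alternating minimization. Normalizing does not change the
profile, and equality yields a fixed point of the unnormalized updates. -/
theorem profile_doubleStep_le (hn : 0 < n) (hp : 0 < p) (hq : 0 < q)
    {Y : Fin n → Matrix (Fin p) (Fin q) ℝ} (hY : Stable Y) {P : Matrix (Fin p) (Fin p) ℝ}
    (hP : P.PosDef) :
    profile Y (doubleStep Y P) ≤ profile Y P ∧
      (profile Y P ≤ profile Y (doubleStep Y P) →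
        P = rowUpdate Y (rowUpdate (fun i => (Y i)ᵀ) P)) := by
  have hQ := rowUpdate_posDef hn hp hY.transpose hP
  have hR := rowUpdate_posDef hn hq hY hQ
  obtain ⟨h1, h2⟩ := objective_rowUpdate_le hn hq hY hP hQ
  have h3 : profile Y (doubleStep Y P) ≤
      objective Y (rowUpdate Y (rowUpdate (fun i => (Y i)ᵀ) P))
        (rowUpdate (fun i => (Y i)ᵀ) P) := by
    rw [doubleStep, normalize, profile_smul hn hp hY (inv_pos.2 (specNorm_pos_of_posDef hp hR)) hR]
    exact profile_le_objective hn hp hY hR hQ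
  exact ⟨h3.trans h1, fun h => h2 (h.trans h3)⟩

/-- A minimizer of the profile on a compact sublevel set cannot be improved by the double step, so
it is fixed. -/
theorem Stable.exists_fixed (hn : 0 < n) (hp : 0 < p) (hq : 0 < q)
    {Y : Fin n → Matrix (Fin p) (Fin q) ℝ} (hY : Stable Y) :
    ∃ P : Matrix (Fin p) (Fin p) ℝ, P.PosDef ∧ specNorm P = 1 ∧
      P = rowUpdate Y (rowUpdate (fun i => (Y i)ᵀ) P) := by
  have h1 : (1 : Matrix (Fin p) (Fin p) ℝ).PosDef := PosDef.one
  set P₀ := normalize (1 : Matrix (Fin p) (Fin p) ℝ)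
  have hP₀ : P₀.PosDef ∧ specNorm P₀ = 1 ∧ profile Y P₀ ≤ profile Y P₀ :=
    ⟨normalize_posDef hp h1, specNorm_normalize hp h1, le_rfl⟩
  obtain ⟨P, hP, hmin⟩ := (isCompact_profile_le hn hp hq hY (profile Y P₀)).exists_isMinOn
    ⟨P₀, hP₀⟩ ((continuousOn_profile hn hp hY).mono fun P hP => hP.1)
  obtain ⟨h2, h3⟩ := profile_doubleStep_le hn hp hq hY hP.1
  have hQ := rowUpdate_posDef hn hp hY.transpose hP.1
  have hR := rowUpdate_posDef hn hq hY hQ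
  exact ⟨P, hP.1, hP.2.1, h3 (hmin ⟨normalize_posDef hp hR, specNorm_normalize hp hR,
    h2.trans hP.2.2⟩)⟩

/-- If `P` is a fixed point of the double step, `(P, rowUpdate Yᵀ P)` is the unique minimum. -/
theorem objective_fixed_le (hn : 0 < n) (hp : 0 < p) (hq : 0 < q)
    {Y : Fin n → Matrix (Fin p) (Fin q) ℝ} (hY : Stable Y) {P P' : Matrix (Fin p) (Fin p) ℝ}
    {Q' : Matrix (Fin q) (Fin q) ℝ} (hP : P.PosDef) (hnorm : specNorm P = 1)
    (hfix : P = rowUpdate Y (rowUpdate (fun i => (Y i)ᵀ) P)) (hP' : P'.PosDef) (hQ' : Q'.PosDef)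
    (hnorm' : specNorm P' = 1) :
    objective Y P (rowUpdate (fun i => (Y i)ᵀ) P) ≤ objective Y P' Q' ∧
      (objective Y P' Q' ≤ objective Y P (rowUpdate (fun i => (Y i)ᵀ) P) →
        P' = P ∧ Q' = rowUpdate (fun i => (Y i)ᵀ) P) := by
  obtain ⟨h1, h2⟩ := objective_le_of_fixed hn hp hq hY hP
    (rowUpdate_posDef hn hp hY.transpose hP) hP' hQ' hfix rfl
  refine ⟨h1, fun h => ?_⟩
  obtain ⟨c, hc, hcP, hcQ⟩ := h2 h
  have : c = 1 := by
    rw [hcP, specNorm_smul_of_nonneg hc.le, hnorm, mul_one] at hnorm'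
    exact hnorm'
  subst this
  exact ⟨by simpa using hcP, by simpa using hcQ⟩

theorem tendsto_iterate_doubleStep (hn : 0 < n) (hp : 0 < p) (hq : 0 < q)
    {Y : Fin n → Matrix (Fin p) (Fin q) ℝ} (hY : Stable Y) {P P₀ : Matrix (Fin p) (Fin p) ℝ}
    (hP : P.PosDef) (hnorm : specNorm P = 1)
    (hfix : P = rowUpdate Y (rowUpdate (fun i => (Y i)ᵀ) P)) (hP₀ : P₀.PosDef)
    (hnorm₀ : specNorm P₀ = 1) :
    Tendsto (fun j => (doubleStep Y)^[j] P₀) atTop (𝓝 P) := by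
  set x := fun j => (doubleStep Y)^[j] P₀ with hx
  have hstep : ∀ j, x (j + 1) = doubleStep Y (x j) := fun j =>
    Function.iterate_succ_apply' _ _ _
  have hQ : ∀ {P : Matrix (Fin p) (Fin p) ℝ}, P.PosDef →
    (rowUpdate (fun i => (Y i)ᵀ) P).PosDef := fun h => rowUpdate_posDef hn hp hY.transpose h
  have hR : ∀ {P : Matrix (Fin p) (Fin p) ℝ}, P.PosDef →
    (rowUpdate Y (rowUpdate (fun i => (Y i)ᵀ) P)).PosDef := fun h => rowUpdate_posDef hn hq hY (hQ h)
  let K := {P : Matrix (Fin p) (Fin p) ℝ | P.PosDef ∧ specNorm P = 1 ∧ profile Y P ≤ profile Y P₀}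
  have hK : IsCompact K := isCompact_profile_le hn hp hq hY _
  have hmem : ∀ j, x j ∈ K := fun j => by
    induction j with
    | zero => exact ⟨hP₀, hnorm₀, le_rfl⟩
    | succ j ih =>
      rw [hstep]
      exact ⟨normalize_posDef hp (hR ih.1), specNorm_normalize hp (hR ih.1),
        (profile_doubleStep_le hn hp hq hY ih.1).1.trans ih.2.2⟩
  have hanti : Antitone fun j => profile Y (x j) := antitone_nat_of_succ_le fun j => by
    rw [hstep]
    exact (profile_doubleStep_le hn hp hq hY (hmem j).1).1
  have hbdd : BddBelow (Set.range fun j => profile Y (x j)) := by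
    refine ⟨objective Y P (rowUpdate (fun i => (Y i)ᵀ) P), ?_⟩
    rintro _ ⟨j, rfl⟩
    exact (objective_fixed_le hn hp hq hY hP hnorm hfix (hmem j).1 (hQ (hmem j).1)
      (hmem j).2.1).1
  have hlim := tendsto_atTop_ciInf hanti hbdd
  set L := ⨅ j, profile Y (x j)
  -- In a compact set it suffices that `P` is the only cluster point. By continuity the profile
  -- takes the limit value `L` both at a cluster point `z` and at its image, so `z` is fixed, and
  -- fixed points of norm one are unique.
  refine hK.tendsto_nhds_of_unique_mapClusterPt (Eventually.of_forall hmem) fun z hz hcl => ?_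
  have : FirstCountableTopology (Matrix (Fin p) (Fin p) ℝ) :=
    inferInstanceAs (FirstCountableTopology (Fin p → Fin p → ℝ))
  obtain ⟨ψ, hψ, hψlim⟩ := hcl.tendsto_subseq
  have hwithin : Tendsto (x ∘ ψ) atTop (𝓝[{P | P.PosDef}] z) :=
    tendsto_nhdsWithin_iff.2 ⟨hψlim, Eventually.of_forall fun j => (hmem _).1⟩
  have hcont := continuousOn_profile hn hp hY
  have hstepc : ContinuousOn (doubleStep Y) {P | P.PosDef} :=
    (continuousOn_normalize hp).comp ((continuousOn_rowUpdate Y).comp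
      (continuousOn_rowUpdate _) fun P hP => hQ hP) fun P hP => hR hP
  have h1 : profile Y z = L := tendsto_nhds_unique
    ((hcont z hz.1).tendsto.comp hwithin) (hlim.comp hψ.tendsto_atTop)
  have hwithin' : Tendsto (fun j => x (ψ j + 1)) atTop (𝓝[{P | P.PosDef}] (doubleStep Y z)) := by
    refine tendsto_nhdsWithin_iff.2 ⟨?_, Eventually.of_forall fun j => (hmem _).1⟩
    simp_rw [hstep]
    exact (hstepc z hz.1).tendsto.comp hwithin
  have h2 : profile Y (doubleStep Y z) = L := tendsto_nhds_unique
    ((hcont _ (normalize_posDef hp (hR hz.1))).tendsto.comp hwithin')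
    (hlim.comp ((tendsto_add_atTop_nat 1).comp hψ.tendsto_atTop))
  have hzfix := (profile_doubleStep_le hn hp hq hY hz.1).2 (by rw [h1, h2])
  exact ((objective_fixed_le hn hp hq hY hP hnorm hfix hz.1 (hQ hz.1) hz.2.1).2
    (objective_fixed_le hn hp hq hY hz.1 hz.2.1 hzfix hP (hQ hP) hnorm).1).1

theorem tendsto_of_even_of_odd {α : Type*} [TopologicalSpace α] {x : ℕ → α} {a : α}
    (h0 : Tendsto (fun j => x (2 * j)) atTop (𝓝 a))
    (h1 : Tendsto (fun j => x (2 * j + 1)) atTop (𝓝 a)) : Tendsto x atTop (𝓝 a) := by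
  refine tendsto_def.2 fun s hs => ?_
  obtain ⟨N, hN⟩ := mem_atTop_sets.1 (h0 hs)
  obtain ⟨N', hN'⟩ := mem_atTop_sets.1 (h1 hs)
  refine mem_atTop_sets.2 ⟨2 * max N N' + 1, fun j hj => ?_⟩
  rcases Nat.even_or_odd' j with ⟨k, rfl | rfl⟩
  · exact hN k (by omega)
  · exact hN' k (by omega)

end FlipFlop

/-! ### From the centered objective back to the likelihood and the flip-flop iteration. -/

section Likelihood

open Matrix

variable {n p q : ℕ}

/-- The samples minus their mean. -/
noncomputable def centered (X : Fin n → Matrix (Fin p) (Fin q) ℝ) (i : Fin n) :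
    Matrix (Fin p) (Fin q) ℝ :=
  X i - sampleMean X

theorem updateP_eq (X : Fin n → Matrix (Fin p) (Fin q) ℝ) (Q : Matrix (Fin q) (Fin q) ℝ) :
    updateP X Q = rowUpdate (centered X) Q := rfl

theorem updateQ_eq (X : Fin n → Matrix (Fin p) (Fin q) ℝ) (P : Matrix (Fin p) (Fin p) ℝ) :
    updateQ X P = rowUpdate (fun i => (centered X i)ᵀ) P := by
  simp [updateQ, rowUpdate, centered]

theorem sum_centered (hn : 0 < n) (X : Fin n → Matrix (Fin p) (Fin q) ℝ) :
    ∑ i, centered X i = 0 := by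
  have : (n : ℝ) ≠ 0 := by positivity
  simp only [centered, Finset.sum_sub_distrib, Finset.sum_const, Finset.card_univ,
    Fintype.card_fin, sampleMean]
  rw [← Nat.cast_smul_eq_nsmul ℝ, smul_smul, mul_one_div_cancel this, one_smul, sub_self]

theorem log_det_kronecker {P : Matrix (Fin p) (Fin p) ℝ} {Q : Matrix (Fin q) (Fin q) ℝ}
    (hP : P.PosDef) (hQ : Q.PosDef) :
    Real.log (P ⊗ₖ Q).det = q * Real.log P.det + p * Real.log Q.det := by
  rw [det_kronecker, Real.log_mul (pow_ne_zero _ hP.det_pos.ne') (pow_ne_zero _ hQ.det_pos.ne'),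
    Real.log_pow, Real.log_pow, Fintype.card_fin, Fintype.card_fin]

/-- The cross terms vanish because the centered samples sum to zero; the remaining quadratic form in
the mean is definite by `trace_quadratic_nonneg`. -/
theorem negLogLik_eq (hn : 0 < n) (X : Fin n → Matrix (Fin p) (Fin q) ℝ)
    (M : Matrix (Fin p) (Fin q) ℝ) {P : Matrix (Fin p) (Fin p) ℝ} {Q : Matrix (Fin q) (Fin q) ℝ}
    (hP : P.PosDef) (hQ : Q.PosDef) :
    negLogLik X M P Q = objective (centered X) P Q +
      (P⁻¹ * (sampleMean X - M) * Q⁻¹ * (sampleMean X - M)ᵀ).trace := by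
  have hn' : (n : ℝ) ≠ 0 := by positivity
  set D := sampleMean X - M with hD
  have hX : ∀ i, X i - M = centered X i + D := fun i => by simp [centered, hD]
  have hexp : ∀ i, (P⁻¹ * (X i - M) * Q⁻¹ * (X i - M)ᵀ).trace =
      (P⁻¹ * centered X i * Q⁻¹ * (centered X i)ᵀ).trace +
        (P⁻¹ * centered X i * (Q⁻¹ * Dᵀ)).trace +
        (P⁻¹ * D * Q⁻¹ * (centered X i)ᵀ).trace + (P⁻¹ * D * Q⁻¹ * Dᵀ).trace := fun i => by
    rw [hX, ← trace_add, ← trace_add, ← trace_add]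
    congr 1
    simp only [transpose_add, Matrix.mul_add, Matrix.add_mul, Matrix.mul_assoc]
    abel
  have h1 : ∑ i, (P⁻¹ * centered X i * (Q⁻¹ * Dᵀ)).trace = 0 := by
    rw [← trace_sum, ← Matrix.sum_mul, ← Matrix.mul_sum, sum_centered hn]
    simp
  have h2 : ∑ i, (P⁻¹ * D * Q⁻¹ * (centered X i)ᵀ).trace = 0 := by
    rw [← trace_sum, ← Matrix.mul_sum, ← transpose_sum, sum_centered hn]
    simp
  rw [negLogLik, objective, log_det_kronecker hP hQ]
  simp_rw [hexp, Finset.sum_add_distrib]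
  rw [h1, h2]
  simp
  field_simp
  ring

theorem trace_quadratic_nonneg {D : Matrix (Fin p) (Fin q) ℝ} {S : Matrix (Fin p) (Fin p) ℝ}
    {T : Matrix (Fin q) (Fin q) ℝ} (hS : S.PosDef) (hT : T.PosDef) :
    0 ≤ (S * D * T * Dᵀ).trace ∧ ((S * D * T * Dᵀ).trace = 0 → D = 0) := by
  obtain ⟨A, hA, rfl⟩ := hS.exists_eq_mul_transpose
  obtain ⟨B, hB, rfl⟩ := hT.exists_eq_mul_transpose
  have h : (A * Aᵀ * D * (B * Bᵀ) * Dᵀ).trace = ((Aᵀ * D * B) * (Aᵀ * D * B)ᴴ).trace := by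
    rw [Matrix.mul_assoc A, Matrix.mul_assoc A, Matrix.mul_assoc A, trace_mul_comm]
    simp only [conjTranspose_eq_transpose_of_trivial, transpose_mul, transpose_transpose,
      Matrix.mul_assoc]
  rw [h]
  refine ⟨(posSemidef_self_mul_conjTranspose _).trace_nonneg, fun h0 => ?_⟩
  have h1 := trace_mul_conjTranspose_self_eq_zero_iff.1 h0
  have hA' : IsUnit (Aᵀ).det := by rwa [det_transpose]
  calc D = (Aᵀ)⁻¹ * (Aᵀ * D * B) * B⁻¹ := by
        rw [Matrix.mul_assoc, Matrix.mul_assoc (Aᵀ * D), mul_nonsing_inv _ hB, Matrix.mul_one,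
          ← Matrix.mul_assoc, nonsing_inv_mul _ hA', Matrix.one_mul]
    _ = 0 := by rw [h1]; simp

/-- For a stable centered sample, the minimum is attained exactly at the sample mean and the fixed
point of the updates. -/
theorem isMLE_iff (hn : 0 < n) (hp : 0 < p) (hq : 0 < q)
    {X : Fin n → Matrix (Fin p) (Fin q) ℝ} (hX : Stable (centered X))
    {P : Matrix (Fin p) (Fin p) ℝ} (hP : P.PosDef) (hnorm : specNorm P = 1)
    (hfix : P = rowUpdate (centered X) (rowUpdate (fun i => (centered X i)ᵀ) P))
    (θ : Matrix (Fin p) (Fin q) ℝ × Matrix (Fin p) (Fin p) ℝ × Matrix (Fin q) (Fin q) ℝ) :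
    IsMLE X θ ↔ θ = (sampleMean X, P, rowUpdate (fun i => (centered X i)ᵀ) P) := by
  have hQ := rowUpdate_posDef hn hp hX.transpose hP
  have hat : negLogLik X (sampleMean X) P (rowUpdate (fun i => (centered X i)ᵀ) P) =
      objective (centered X) P (rowUpdate (fun i => (centered X i)ᵀ) P) := by
    rw [negLogLik_eq hn X _ hP hQ]
    simp
  constructor
  · rintro ⟨⟨hP', hQ', hnorm'⟩, hmin⟩
    obtain ⟨M', P', Q'⟩ := θ
    dsimp only at hP' hQ' hnorm' hmin
    have h1 := hmin (sampleMean X) (P, rowUpdate (fun i => (centered X i)ᵀ) P) ⟨hP, hQ, hnorm⟩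
    rw [hat, negLogLik_eq hn X _ hP' hQ'] at h1
    obtain ⟨h2, h3⟩ := trace_quadratic_nonneg (D := sampleMean X - M') hP'.inv hQ'.inv
    obtain ⟨h4, h5⟩ := objective_fixed_le hn hp hq hX hP hnorm hfix hP' hQ' hnorm'
    obtain ⟨rfl, rfl⟩ := h5 (by linarith)
    rw [← sub_eq_zero.1 (h3 (by linarith))]
  · rintro rfl
    refine ⟨⟨hP, hQ, hnorm⟩, fun M PQ hPQ => ?_⟩
    rw [hat, negLogLik_eq hn X _ hPQ.1 hPQ.2.1]
    have h2 := (trace_quadratic_nonneg (D := sampleMean X - M) hPQ.1.inv hPQ.2.1.inv).1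
    have h4 := (objective_fixed_le hn hp hq hX hP hnorm hfix hPQ.1 hPQ.2.1 hPQ.2.2).1
    linarith

theorem existsUnique_isMLE (hn : 0 < n) (hp : 0 < p) (hq : 0 < q)
    {X : Fin n → Matrix (Fin p) (Fin q) ℝ} (hX : Stable (centered X)) : ∃! θ, IsMLE X θ := by
  obtain ⟨P, hP, hnorm, hfix⟩ := hX.exists_fixed hn hp hq
  exact ⟨_, (isMLE_iff hn hp hq hX hP hnorm hfix _).2 rfl,
    fun θ => (isMLE_iff hn hp hq hX hP hnorm hfix θ).1⟩

/-- The second factor is normalized in the last limit because one step sends `(P*, c Q*)` to `(P*,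
c⁻¹ Q*)`, so the scale of `Q_j` may oscillate. -/
theorem flipFlop_converges (hn : 0 < n) (hp : 0 < p) (hq : 0 < q)
    {X : Fin n → Matrix (Fin p) (Fin q) ℝ} (hX : Stable (centered X))
    {θ : Matrix (Fin p) (Fin q) ℝ × Matrix (Fin p) (Fin p) ℝ × Matrix (Fin q) (Fin q) ℝ}
    (hθ : IsMLE X θ) {PQ₀ : Matrix (Fin p) (Fin p) ℝ × Matrix (Fin q) (Fin q) ℝ}
    (h₀ : PQ₀ ∈ covPairs p q) :
    (∀ j, flipFlop X PQ₀ j ∈ covPairs p q) ∧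
      Tendsto (fun j => (sampleMean X, (flipFlop X PQ₀ j).1, updateQ X (flipFlop X PQ₀ j).1))
        atTop (𝓝 θ) ∧
      Tendsto (fun j => (specNorm (flipFlop X PQ₀ j).2)⁻¹ • (flipFlop X PQ₀ j).2)
        atTop (𝓝 ((specNorm θ.2.2)⁻¹ • θ.2.2)) := by
  obtain ⟨P, hP, hnorm, hfix⟩ := hX.exists_fixed hn hp hq
  obtain rfl := (isMLE_iff hn hp hq hX hP hnorm hfix θ).1 hθ
  have hU : ∀ {Q : Matrix (Fin q) (Fin q) ℝ}, Q.PosDef → (rowUpdate (centered X) Q).PosDef :=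
    fun h => rowUpdate_posDef hn hq hX h
  have hV : ∀ {P : Matrix (Fin p) (Fin p) ℝ}, P.PosDef →
    (rowUpdate (fun i => (centered X i)ᵀ) P).PosDef :=
    fun h => rowUpdate_posDef hn hp hX.transpose h
  set x := flipFlop X PQ₀ with hx
  have hstep : ∀ j, x (j + 1) = flipFlopStep X (x j) := fun j =>
    Function.iterate_succ_apply' _ _ _
  have hstep1 : ∀ j, (x (j + 1)).1 = normalize (rowUpdate (centered X) (x j).2) := fun j => by
    rw [hstep, flipFlopStep, updateP_eq]
    rfl
  have hstep2 : ∀ j, (x (j + 1)).2 = specNorm (rowUpdate (centered X) (x j).2) •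
      rowUpdate (fun i => (centered X i)ᵀ) (x j).1 := fun j => by
    rw [hstep, flipFlopStep, updateP_eq, updateQ_eq]
  have hmem : ∀ j, x j ∈ covPairs p q := fun j => by
    induction j with
    | zero => exact h₀
    | succ j ih =>
      refine ⟨?_, ?_, ?_⟩
      · rw [hstep1]; exact normalize_posDef hp (hU ih.2.1)
      · rw [hstep2]; exact (hV ih.1).smul (specNorm_pos_of_posDef hp (hU ih.2.1))
      · rw [hstep1]; exact specNorm_normalize hp (hU ih.2.1)
  -- The scale put on the second factor only rescales the next update of the first and is removed by
  -- the normalization.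
  have hdouble : ∀ j, (x (j + 2)).1 = doubleStep (centered X) (x j).1 := fun j => by
    have hc := specNorm_pos_of_posDef hp (hU (hmem j).2.1)
    rw [hstep1, hstep2, rowUpdate_smul hc (hV (hmem j).1), normalize_smul (inv_pos.2 hc)]
    rfl
  have hiter : ∀ r j, (x (2 * j + r)).1 = (doubleStep (centered X))^[j] (x r).1 := fun r j => by
    induction j with
    | zero => simp
    | succ j ih =>
      rw [Function.iterate_succ_apply', ← ih, ← hdouble]
      congr 2
      ring
  have hlim : ∀ r, Tendsto (fun j => (x (2 * j + r)).1) atTop (𝓝 P) := fun r => by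
    simp_rw [hiter]
    exact tendsto_iterate_doubleStep hn hp hq hX hP hnorm hfix (hmem r).1 (hmem r).2.2
  have hPlim : Tendsto (fun j => (x j).1) atTop (𝓝 P) :=
    tendsto_of_even_of_odd (hlim 0) (hlim 1)
  have hwithin : Tendsto (fun j => (x j).1) atTop (𝓝[{P | P.PosDef}] P) :=
    tendsto_nhdsWithin_iff.2 ⟨hPlim, Eventually.of_forall fun j => (hmem j).1⟩
  have hQlim : Tendsto (fun j => rowUpdate (fun i => (centered X i)ᵀ) (x j).1) atTop
      (𝓝 (rowUpdate (fun i => (centered X i)ᵀ) P)) :=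
    (continuousOn_rowUpdate _ P hP).tendsto.comp hwithin
  refine ⟨hmem, ?_, ?_⟩
  · simp_rw [updateQ_eq]
    exact tendsto_const_nhds.prodMk_nhds (hPlim.prodMk_nhds hQlim)
  · rw [← tendsto_add_atTop_iff_nat 1]
    have hnormalize : ∀ j, (specNorm (x (j + 1)).2)⁻¹ • (x (j + 1)).2 =
        normalize (rowUpdate (fun i => (centered X i)ᵀ) (x j).1) := fun j => by
      rw [hstep2]
      exact normalize_smul (specNorm_pos_of_posDef hp (hU (hmem j).2.1)) _
    simp_rw [hnormalize]
    exact (continuousOn_normalize hq _ (hV hP)).tendsto.comp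
      (tendsto_nhdsWithin_iff.2 ⟨hQlim, Eventually.of_forall fun j => hV (hmem j).1⟩)

end Likelihood

/-! ### Almost every sample is stable: parametrization and dimension count. -/

section Generic

open Matrix

/-- A `C¹` image has Hausdorff dimension at most that of the source, so its Hausdorff measure in the
dimension of the target vanishes. -/
theorem volume_range_eq_zero {E F : Type*} [NormedAddCommGroup E] [NormedSpace ℝ E]
    [FiniteDimensional ℝ E] [NormedAddCommGroup F] [NormedSpace ℝ F] [FiniteDimensional ℝ F]
    [MeasurableSpace F] [BorelSpace F] (μ : Measure F) [μ.IsAddHaarMeasure] {f : E → F}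
    (hf : ContDiff ℝ 1 f) (hlt : Module.finrank ℝ E < Module.finrank ℝ F) :
    μ (Set.range f) = 0 := by
  have h1 : dimH (Set.range f) < ((Module.finrank ℝ F : NNReal) : ENNReal) :=
    hf.dimH_range_le.trans_lt (by exact_mod_cast hlt)
  have h2 := hausdorffMeasure_of_dimH_lt h1
  have h3 : μ ≪ (Measure.hausdorffMeasure (Module.finrank ℝ F : ℝ) : Measure F) :=
    Measure.absolutelyContinuous_isAddHaarMeasure _ _
  exact h3 (by simpa using h2)

theorem pi_absolutelyContinuous {α : Type*} [MeasurableSpace α] {n : ℕ}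
    (μ ν : Fin n → Measure α) [∀ i, SigmaFinite (μ i)] [∀ i, SigmaFinite (ν i)]
    (h : ∀ i, μ i ≪ ν i) : Measure.pi μ ≪ Measure.pi ν := by
  induction n with
  | zero => rw [Measure.pi_of_empty μ, Measure.pi_of_empty ν]
  | succ n ih =>
    have h1 := (measurePreserving_piFinSuccAbove μ 0).symm
    have h2 := (measurePreserving_piFinSuccAbove ν 0).symm
    rw [← h1.map_eq, ← h2.map_eq]
    exact ((h 0).prod (ih _ _ fun i => h _)).map (MeasurableEquiv.measurable _)

/-- A subspace of dimension `r` has a basis in reduced echelon form with respect to some set of `r`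
pivot coordinates. -/
theorem exists_pivot_basis {r p : ℕ} {u : Fin r → Fin p → ℝ} (hu : LinearIndependent ℝ u) :
    ∃ (K : Finset (Fin p)) (R : Fin p → Fin p → ℝ), K.card = r ∧
      (∀ k ∈ K, R k ∈ Submodule.span ℝ (Set.range u)) ∧
      ∀ k ∈ K, ∀ a ∈ K, R k a = if k = a then 1 else 0 := by
  classical
  let A : Matrix (Fin r) (Fin p) ℝ := Matrix.of u
  obtain ⟨κ, c, hc, hspan, hind⟩ := exists_linearIndependent' ℝ A.col
  have : Fintype κ := Fintype.ofInjective c hc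
  have hcard : Fintype.card κ = r := by
    have h1 := finrank_span_eq_card hind
    rw [hspan, ← rank_eq_finrank_span_cols] at h1
    have h2 := LinearIndependent.rank_matrix (M := A) hu
    rw [h2, Fintype.card_fin] at h1
    exact h1.symm
  let e : Fin r ≃ κ := (Fintype.equivFinOfCardEq hcard).symm
  -- `S` is the invertible minor on the pivot columns, so `S⁻¹ * A` spans the same rows and
  -- restricts to the identity there. `R` relabels its rows by their pivots.
  let S : Matrix (Fin r) (Fin r) ℝ := A.submatrix id (c ∘ e)
  have hS : IsUnit S.det := by
    have h1 : LinearIndependent ℝ Sᵀ.row := LinearIndependent.comp hind e e.injective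
    rw [linearIndependent_rows_iff_isUnit, isUnit_iff_isUnit_det, det_transpose] at h1
    exact h1
  have hinj : Function.Injective (c ∘ e) := hc.comp e.injective
  let R : Fin p → Fin p → ℝ := Function.extend (c ∘ e) (S⁻¹ * A) 0
  have hR : ∀ j, R (c (e j)) = (S⁻¹ * A) j := fun j => hinj.extend_apply _ _ j
  refine ⟨Finset.univ.image (c ∘ e), R, ?_, ?_, ?_⟩
  · rw [Finset.card_image_of_injective _ hinj, Finset.card_univ, Fintype.card_fin]
  · intro k hk
    obtain ⟨j, -, rfl⟩ := Finset.mem_image.1 hk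
    have : R ((c ∘ e) j) = ∑ i, S⁻¹ j i • u i := by
      rw [Function.comp_apply, hR]
      ext a
      rw [mul_apply, Finset.sum_apply]
      rfl
    rw [this]
    exact Submodule.sum_mem _ fun i _ => Submodule.smul_mem _ _ (Submodule.subset_span ⟨i, rfl⟩)
  · intro k hk a ha
    obtain ⟨j, -, rfl⟩ := Finset.mem_image.1 hk
    obtain ⟨i, -, rfl⟩ := Finset.mem_image.1 ha
    have h1 : R ((c ∘ e) j) ((c ∘ e) i) = (S⁻¹ * S) j i := by
      rw [Function.comp_apply, hR]
      rfl
    rw [h1, nonsing_inv_mul _ hS, one_apply]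
    simp only [hinj.eq_iff]

theorem dotProduct_mulVec_eq_zero_of_mem_span {p q : ℕ} {ι κ : Type*} {u : ι → Fin p → ℝ}
    {v : κ → Fin q → ℝ} {Z : Matrix (Fin p) (Fin q) ℝ} (h : ∀ k l, u k ⬝ᵥ (Z *ᵥ v l) = 0)
    {x : Fin p → ℝ} {y : Fin q → ℝ} (hx : x ∈ Submodule.span ℝ (Set.range u))
    (hy : y ∈ Submodule.span ℝ (Set.range v)) : x ⬝ᵥ (Z *ᵥ y) = 0 := by
  have h1 : ∀ k, u k ⬝ᵥ (Z *ᵥ y) = 0 := fun k => by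
    refine Submodule.span_induction (p := fun y _ => u k ⬝ᵥ (Z *ᵥ y) = 0) ?_ ?_ ?_ ?_ hy
    · rintro _ ⟨l, rfl⟩
      exact h k l
    · simp
    · intro a b _ _ ha hb
      rw [mulVec_add, dotProduct_add, ha, hb, add_zero]
    · intro c a _ ha
      rw [mulVec_smul, dotProduct_smul, ha, smul_zero]
  refine Submodule.span_induction (p := fun x _ => x ⬝ᵥ (Z *ᵥ y) = 0) ?_ ?_ ?_ ?_ hx
  · rintro _ ⟨k, rfl⟩
    exact h1 k
  · simp
  · intro a b _ _ ha hb
    rw [add_dotProduct, ha, hb, add_zero]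
  · intro c a _ ha
    rw [smul_dotProduct, ha, smul_zero]

variable {m p q : ℕ}

/-- Parameters of the samples that have a common block of zeros with pivot rows `K` and pivot
columns `L`. -/
abbrev BlockParam (m : ℕ) {p q : ℕ} (K : Finset (Fin p)) (L : Finset (Fin q)) : Type :=
  ↥(K ×ˢ Kᶜ) ⊕ ↥(L ×ˢ Lᶜ) ⊕ (Fin p × Fin q) ⊕ (Fin m × ↥((K ×ˢ L)ᶜ))

/-- The echelon basis with pivots `K` and remaining entries `x`. -/
def echelon {d : ℕ} (K : Finset (Fin d)) (x : ↥(K ×ˢ Kᶜ) → ℝ) (k a : Fin d) : ℝ :=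
  if h : (k, a) ∈ K ×ˢ Kᶜ then x ⟨(k, a), h⟩ else if k = a then 1 else 0

/-- The difference between a sample and the first one: its entries in the pivot block are
determined by the others and by the two echelon bases. -/
def blockDiff (K : Finset (Fin p)) (L : Finset (Fin q)) (x : BlockParam m K L → ℝ) (i : Fin m)
    (a : Fin p) (b : Fin q) : ℝ :=
  if h : (a, b) ∈ (K ×ˢ L)ᶜ then x (.inr (.inr (.inr (i, ⟨(a, b), h⟩))))
  else -∑ c : ↥((K ×ˢ L)ᶜ), echelon K (fun z => x (.inl z)) a c.1.1 *
    x (.inr (.inr (.inr (i, c)))) * echelon L (fun z => x (.inr (.inl z))) b c.1.2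

/-- The samples with given parameters. -/
def blockSample (K : Finset (Fin p)) (L : Finset (Fin q)) (x : BlockParam m K L → ℝ) :
    Fin (m + 1) → Fin p → Fin q → ℝ := fun i a b =>
  x (.inr (.inr (.inl (a, b)))) + (Fin.cases 0 (fun i => blockDiff K L x i a b) i : ℝ)

theorem contDiff_echelon {d : ℕ} {E : Type*} [NormedAddCommGroup E] [NormedSpace ℝ E]
    (K : Finset (Fin d)) {f : E → ↥(K ×ˢ Kᶜ) → ℝ} (hf : ∀ z, ContDiff ℝ 1 fun x => f x z)
    (k a : Fin d) : ContDiff ℝ 1 fun x => echelon K (f x) k a := by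
  unfold echelon
  split_ifs
  · exact hf _
  · exact contDiff_const
  · exact contDiff_const

theorem contDiff_blockSample (K : Finset (Fin p)) (L : Finset (Fin q)) :
    ContDiff ℝ 1 (blockSample (m := m) K L) := by
  refine contDiff_pi.2 fun i => contDiff_pi.2 fun a => contDiff_pi.2 fun b => ?_
  refine (contDiff_apply ℝ ℝ _).add ?_
  refine Fin.cases contDiff_const (fun i => ?_) i
  show ContDiff ℝ 1 fun x => blockDiff K L x i a b
  unfold blockDiff
  split_ifs
  · exact contDiff_apply ℝ ℝ _
  · refine (ContDiff.sum fun c _ => ?_).neg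
    exact ((contDiff_echelon K (fun z => contDiff_apply ℝ ℝ _) _ _).mul
      (contDiff_apply ℝ ℝ _)).mul (contDiff_echelon L (fun z => contDiff_apply ℝ ℝ _) _ _)

/-- On the pivot block the echelon bases are Kronecker deltas, so each vanishing bilinear equation
contains exactly one pivot entry, with coefficient one, and can be solved for it. -/
theorem mem_range_blockSample {X : Fin (m + 1) → Fin p → Fin q → ℝ} {K : Finset (Fin p)}
    {L : Finset (Fin q)} {R : Fin p → Fin p → ℝ} {C : Fin q → Fin q → ℝ}
    (hR : ∀ k ∈ K, ∀ a ∈ K, R k a = if k = a then 1 else 0)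
    (hC : ∀ l ∈ L, ∀ b ∈ L, C l b = if l = b then 1 else 0)
    (h : ∀ i : Fin m, ∀ k ∈ K, ∀ l ∈ L,
      ∑ a, ∑ b, R k a * (X i.succ a b - X 0 a b) * C l b = 0) :
    X ∈ Set.range (blockSample (m := m) K L) := by
  let x : BlockParam m K L → ℝ := Sum.elim (fun z => R z.1.1 z.1.2) (Sum.elim
    (fun z => C z.1.1 z.1.2) (Sum.elim (fun ab => X 0 ab.1 ab.2)
      fun z => X z.1.succ z.2.1.1 z.2.1.2 - X 0 z.2.1.1 z.2.1.2))
  have hRx : ∀ k ∈ K, ∀ a, echelon K (fun z => x (.inl z)) k a = R k a := fun k hk a => by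
    unfold echelon
    by_cases ha : a ∈ K
    · rw [dif_neg (by simp [ha]), hR k hk a ha]
    · rw [dif_pos (by simp [ha, hk])]
      rfl
  have hCx : ∀ l ∈ L, ∀ b, echelon L (fun z => x (.inr (.inl z))) l b = C l b := fun k hk a => by
    unfold echelon
    by_cases ha : a ∈ L
    · rw [dif_neg (by simp [ha]), hC k hk a ha]
    · rw [dif_pos (by simp [ha, hk])]
      rfl
  refine ⟨x, ?_⟩
  ext i a b
  refine Fin.cases (by simp [blockSample, x]) (fun i => ?_) i
  have hx0 : x (.inr (.inr (.inl (a, b)))) = X 0 a b := rfl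
  suffices blockDiff K L x i a b = X i.succ a b - X 0 a b by
    simp only [blockSample, Fin.cases_succ, this, hx0]
    ring
  unfold blockDiff
  split_ifs with hab
  · rfl
  · rw [Finset.mem_compl, not_not, Finset.mem_product] at hab
    have h1 := h i a hab.1 b hab.2
    rw [← Fintype.sum_prod_type' (f := fun a' b' => R a a' * (X i.succ a' b' - X 0 a' b') * C b b'),
      ← Finset.sum_add_sum_compl (K ×ˢ L)] at h1
    have h2 : ∑ c ∈ K ×ˢ L, R a c.1 * (X i.succ c.1 c.2 - X 0 c.1 c.2) * C b c.2 =
        X i.succ a b - X 0 a b := by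
      rw [Finset.sum_eq_single (a, b)]
      · rw [hR a hab.1 a hab.1, hC b hab.2 b hab.2]
        simp
      · rintro ⟨a', b'⟩ hc hne
        obtain ⟨ha', hb'⟩ := Finset.mem_product.1 hc
        rw [hR a hab.1 a' ha', hC b hab.2 b' hb']
        by_cases h3 : a = a'
        · have : b ≠ b' := fun h4 => hne (by rw [h3, h4])
          simp [this]
        · simp [h3]
      · exact fun hc => absurd (Finset.mem_product.2 hab) hc
    rw [h2, ← Finset.sum_coe_sort (K ×ˢ L)ᶜ] at h1
    rw [neg_eq_iff_add_eq_zero, add_comm, ← h1]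
    congr 1
    refine Finset.sum_congr rfl fun c _ => ?_
    rw [hRx a hab.1, hCx b hab.2]
    rfl

/-- With `r = |K|` and `t = |L|`, the bases cost `r(p-r) + t(q-t)` parameters and the block saves `m
r t`. The violated stability inequality reads `(p-r) q ≤ t p` and `(q-t) p ≤ r q`, so `p q` times
the cost is at most `(p² + q²) r t`, which is less than `m p q r t`. -/
theorem card_blockParam_lt (hm : p ^ 2 + q ^ 2 < m * (p * q)) {K : Finset (Fin p)}
    {L : Finset (Fin q)} (hK : K.Nonempty) (hL : L.Nonempty)
    (h : p * q ≤ K.card * q + L.card * p) :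
    Fintype.card (BlockParam m K L) < (m + 1) * (p * q) := by
  have hr : K.card ≤ p := by simpa using K.card_le_univ
  have ht : L.card ≤ q := by simpa using L.card_le_univ
  have hrt : K.card * L.card ≤ p * q := Nat.mul_le_mul hr ht
  simp only [Fintype.card_sum, Fintype.card_prod, Fintype.card_fin, Fintype.card_coe,
    Finset.card_product, Finset.card_compl]
  have hr0 := hK.card_pos
  have ht0 := hL.card_pos
  generalize K.card = r at *
  generalize L.card = t at *
  obtain ⟨r', rfl⟩ := Nat.exists_eq_add_of_le hr
  obtain ⟨t', rfl⟩ := Nat.exists_eq_add_of_le ht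
  obtain ⟨s, hs⟩ := Nat.exists_eq_add_of_le hrt
  rw [hs, Nat.add_sub_cancel_left, Nat.add_sub_cancel_left, Nat.add_sub_cancel_left]
  have h1 : r' * (t + t') ≤ t * (r + r') := by nlinarith
  have h2 : t' * (r + r') ≤ r * (t + t') := by nlinarith
  have h3 : ((r + r') * (t + t')) * (r * r' + t * t') < ((r + r') * (t + t')) * (m * (r * t)) := by
    calc ((r + r') * (t + t')) * (r * r' + t * t')
        = (r + r') * r * (r' * (t + t')) + (t + t') * t * (t' * (r + r')) := by ring
      _ ≤ (r + r') * r * (t * (r + r')) + (t + t') * t * (r * (t + t')) := by gcongr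
      _ = ((r + r') ^ 2 + (t + t') ^ 2) * (r * t) := by ring
      _ < (m * ((r + r') * (t + t'))) * (r * t) := by
        exact Nat.mul_lt_mul_of_pos_right hm (Nat.mul_pos hr0 ht0)
      _ = _ := by ring
  have h4 := Nat.lt_of_mul_lt_mul_left h3
  nlinarith

theorem isAddHaarMeasure_volume_samples (n p q : ℕ) :
    (volume : Measure (Fin n → Fin p → Fin q → ℝ)).IsAddHaarMeasure := by
  have h1 : (volume : Measure (Fin p → Fin q → ℝ)).IsAddHaarMeasure :=
    Measure.pi.isAddHaarMeasure fun _ : Fin p => (volume : Measure (Fin q → ℝ))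
  exact Measure.pi.isAddHaarMeasure fun _ : Fin n => (volume : Measure (Fin p → Fin q → ℝ))

/-- Differences with the first sample do not involve the mean and inherit every common zero block,
so an unstable sample lies in one of finitely many ranges of `blockSample`. -/
theorem volume_not_stable (hm : p ^ 2 + q ^ 2 < m * (p * q)) :
    (volume : Measure (Fin (m + 1) → Fin p → Fin q → ℝ))
      {X | ¬ Stable (centered (p := p) (q := q) X)} = 0 := by
  classical
  let good : Set (Finset (Fin p) × Finset (Fin q)) :=
    {KL | KL.1.Nonempty ∧ KL.2.Nonempty ∧ p * q ≤ KL.1.card * q + KL.2.card * p}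
  have hnull : (volume : Measure (Fin (m + 1) → Fin p → Fin q → ℝ))
      (⋃ KL ∈ good, Set.range (blockSample (m := m) KL.1 KL.2)) = 0 := by
    refine (measure_biUnion_null_iff good.to_countable).2 fun KL hKL => ?_
    have := isAddHaarMeasure_volume_samples (m + 1) p q
    refine volume_range_eq_zero volume (contDiff_blockSample KL.1 KL.2) ?_
    have := card_blockParam_lt hm hKL.1 hKL.2.1 hKL.2.2
    simpa [Module.finrank_pi_fintype, Module.finrank_pi] using this
  refine measure_mono_null (fun X hX => ?_) hnull
  simp only [Set.mem_ofPred_eq, Stable, not_forall, not_lt] at hX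
  obtain ⟨r, t, u, v, hu, hv, hr, ht, h0, hle⟩ := hX
  obtain ⟨K, R, hKr, hRspan, hR⟩ := exists_pivot_basis hu
  obtain ⟨L, C, hLt, hCspan, hC⟩ := exists_pivot_basis hv
  have hK : K.Nonempty := Finset.card_pos.1 (hKr ▸ hr)
  have hL : L.Nonempty := Finset.card_pos.1 (hLt ▸ ht)
  refine Set.mem_biUnion (x := (K, L)) ⟨hK, hL, by rw [hKr, hLt]; exact hle⟩ ?_
  refine mem_range_blockSample hR hC fun i k hk l hl => ?_
  have h1 := dotProduct_mulVec_eq_zero_of_mem_span (h0 i.succ) (hRspan k hk) (hCspan l hl)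
  have h2 := dotProduct_mulVec_eq_zero_of_mem_span (h0 0) (hRspan k hk) (hCspan l hl)
  have h3 : R k ⬝ᵥ ((centered (p := p) (q := q) X i.succ -
      centered (p := p) (q := q) X 0) *ᵥ C l) = 0 := by
    rw [sub_mulVec, dotProduct_sub, h1, h2, sub_zero]
  have h4 : ∀ a b, (centered (p := p) (q := q) X i.succ - centered (p := p) (q := q) X 0) a b =
      X i.succ a b - X 0 a b := fun a b => by
    exact sub_sub_sub_cancel_right _ _ _
  rw [← h3, dotProduct]
  refine Finset.sum_congr rfl fun a _ => ?_
  rw [mulVec, dotProduct, Finset.mul_sum]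
  exact Finset.sum_congr rfl fun b _ => by rw [h4, mul_assoc]

end Generic

/-! ### Nonexistence of a minimum below the lower threshold. -/

section LowerThreshold

open Matrix

variable {m n p q : ℕ}

/-- Only `m` of the centered samples are free: `m * q` linear conditions on `p` unknowns have a
nonzero solution, and the first sample is minus the sum of the others. -/
theorem exists_left_kernel {Y : Fin (m + 1) → Matrix (Fin p) (Fin q) ℝ} (hY : ∑ i, Y i = 0)
    (hlt : m * q < p) : ∃ v : Fin p → ℝ, v ≠ 0 ∧ ∀ i, v ᵥ* Y i = 0 := by
  let f : (Fin p → ℝ) →ₗ[ℝ] Fin m → Fin q → ℝ :=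
    LinearMap.pi fun i => (Y (Fin.succ i)).vecMulLinear
  have hf : LinearMap.ker f ≠ ⊥ := LinearMap.ker_ne_bot_of_finrank_lt (by
    simpa [Module.finrank_pi_fintype] using hlt)
  obtain ⟨v, hv, hv0⟩ := Submodule.exists_mem_ne_zero_of_ne_bot hf
  have hsucc : ∀ i : Fin m, v ᵥ* Y i.succ = 0 := fun i => congrFun (LinearMap.mem_ker.1 hv) i
  refine ⟨v, hv0, fun i => Fin.cases ?_ hsucc i⟩
  have h : v ᵥ* ∑ i, Y i = 0 := by rw [hY, vecMul_zero]
  rwa [vecMul_sum, Fin.sum_univ_succ, Finset.sum_eq_zero fun i _ => hsucc i, add_zero] at h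

/-- If a direction of the row space is orthogonal to all columns of all samples, the objective can
always be decreased. -/
theorem exists_objective_lt {Y : Fin n → Matrix (Fin p) (Fin q) ℝ} (hq : 0 < q) {v : Fin p → ℝ}
    (hv : v ≠ 0) (hY : ∀ i, v ᵥ* Y i = 0) {P : Matrix (Fin p) (Fin p) ℝ} (hP : P.PosDef)
    (Q : Matrix (Fin q) (Fin q) ℝ) :
    ∃ P' : Matrix (Fin p) (Fin p) ℝ, P'.PosDef ∧ objective Y P' Q < objective Y P Q := by
  have hvv : (vecMulVec v v).PosSemidef := by simpa using posSemidef_vecMulVec_self_star v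
  have hne : vecMulVec v v ≠ 0 := fun h => hv <| funext fun i => by
    simpa [vecMulVec_apply] using congrFun (congrFun h i) i
  have hS : (P⁻¹ + vecMulVec v v).PosDef := hP.inv.add_posSemidef hvv
  have hdet := (hP.inv.det_le_det_add hvv).2 hne
  -- Adding `v vᵀ` to the inverse covariance leaves the trace term unchanged, as `v` annihilates the
  -- samples, and strictly increases the determinant of the inverse.
  refine ⟨(P⁻¹ + vecMulVec v v)⁻¹, hS.inv, ?_⟩
  have hinv := nonsing_inv_nonsing_inv _ ((isUnit_iff_isUnit_det _).1 hS.isUnit)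
  have hlog : Real.log (P⁻¹ + vecMulVec v v)⁻¹.det < Real.log P.det := by
    have h1 := Real.log_lt_log hP.inv.det_pos hdet
    rw [det_nonsing_inv, Ring.inverse_eq_inv', Real.log_inv] at h1 ⊢
    linarith
  have hq' : (0 : ℝ) < q := by positivity
  unfold objective
  rw [hinv]
  have htr : ∀ i, (P⁻¹ + vecMulVec v v) * Y i = P⁻¹ * Y i := fun i => by
    have h0 : vecMulVec v (0 : Fin q → ℝ) = 0 := by ext; simp [vecMulVec_apply]
    rw [Matrix.add_mul, vecMulVec_mul, hY, h0, add_zero]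
  simp only [htr]
  gcongr

/-- Invariance of the objective under `(c P, c⁻¹ Q)` removes the constraint on the norm of `P`. -/
theorem IsMLE.objective_le (hn : 0 < n) (hp : 0 < p) {X : Fin n → Matrix (Fin p) (Fin q) ℝ}
    {θ : Matrix (Fin p) (Fin q) ℝ × Matrix (Fin p) (Fin p) ℝ × Matrix (Fin q) (Fin q) ℝ}
    (hθ : IsMLE X θ) {P : Matrix (Fin p) (Fin p) ℝ} {Q : Matrix (Fin q) (Fin q) ℝ}
    (hP : P.PosDef) (hQ : Q.PosDef) :
    objective (centered X) θ.2.1 θ.2.2 ≤ objective (centered X) P Q := by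
  obtain ⟨⟨hP', hQ', -⟩, hmin⟩ := hθ
  have hs := specNorm_pos_of_posDef hp hP
  have hQs : ((specNorm P)⁻¹⁻¹ • Q).PosDef := hQ.smul (by rwa [inv_inv])
  have h1 := hmin (sampleMean X) (normalize P, (specNorm P)⁻¹⁻¹ • Q)
    ⟨normalize_posDef hp hP, hQs, specNorm_normalize hp hP⟩
  dsimp only at h1
  rw [negLogLik_eq hn X _ hP' hQ', negLogLik_eq hn X _ (normalize_posDef hp hP) hQs,
    normalize, objective_smul (inv_pos.2 hs) hP hQ, sub_self] at h1
  have h2 := (trace_quadratic_nonneg (D := sampleMean X - θ.1) hP'.inv hQ'.inv).1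
  simp only [Matrix.mul_zero, Matrix.zero_mul, trace_zero] at h1
  linarith

/-- Without samples the trace term is zero, and halving `Q` lowers the log-determinant. -/
theorem not_isMLE_of_fin_zero (hp : 0 < p) (hq : 0 < q) {X : Fin 0 → Matrix (Fin p) (Fin q) ℝ}
    {θ : Matrix (Fin p) (Fin q) ℝ × Matrix (Fin p) (Fin p) ℝ × Matrix (Fin q) (Fin q) ℝ} :
    ¬ IsMLE X θ := by
  rintro ⟨⟨hP, hQ, hnorm⟩, hmin⟩
  have hQ' : ((1 / 2 : ℝ) • θ.2.2).PosDef := hQ.smul (by norm_num)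
  have h1 := hmin 0 (θ.2.1, (1 / 2 : ℝ) • θ.2.2) ⟨hP, hQ', hnorm⟩
  simp only [negLogLik, Finset.univ_eq_empty, Finset.sum_empty] at h1
  rw [log_det_kronecker hP hQ, log_det_kronecker hP hQ', det_smul,
    Real.log_mul (by positivity) hQ.det_pos.ne', Real.log_pow, Fintype.card_fin] at h1
  have h2 : Real.log (1 / 2) < 0 := Real.log_neg (by norm_num) (by norm_num)
  have h3 : (p : ℝ) * (q * Real.log (1 / 2)) < 0 :=
    mul_neg_of_pos_of_neg (by positivity) (mul_neg_of_pos_of_neg (by positivity) h2)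
  linarith

theorem not_isMLE_of_lt (hp : 0 < p) (hq : 0 < q)
    (hn : (n : ℝ) < max ((p : ℝ) / q) ((q : ℝ) / p) + 1) {X : Fin n → Matrix (Fin p) (Fin q) ℝ}
    {θ : Matrix (Fin p) (Fin q) ℝ × Matrix (Fin p) (Fin p) ℝ × Matrix (Fin q) (Fin q) ℝ} :
    ¬ IsMLE X θ := by
  rcases n with _ | m
  · exact not_isMLE_of_fin_zero hp hq
  intro hθ
  have hp' : (0 : ℝ) < p := by positivity
  have hq' : (0 : ℝ) < q := by positivity
  have hsum := sum_centered m.succ_pos X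
  rw [Nat.cast_add, Nat.cast_one, add_lt_add_iff_right, lt_max_iff, lt_div_iff₀ hq',
    lt_div_iff₀ hp'] at hn
  rcases hn with hn | hn
  · obtain ⟨v, hv, hvY⟩ := exists_left_kernel hsum (by exact_mod_cast hn)
    obtain ⟨P', hP', hlt⟩ := exists_objective_lt hq hv hvY hθ.1.1 θ.2.2
    exact hlt.not_ge (hθ.objective_le m.succ_pos hp hP' hθ.1.2.1)
  · obtain ⟨v, hv, hvY⟩ := exists_left_kernel (Y := fun i => (centered X i)ᵀ)
      (by rw [← transpose_sum, hsum, transpose_zero]) (by exact_mod_cast hn)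
    obtain ⟨Q', hQ', hlt⟩ := exists_objective_lt hp hv hvY hθ.1.2.1 θ.2.1
    rw [objective_transpose, objective_transpose] at hlt
    exact hlt.not_ge (hθ.objective_le m.succ_pos hp hθ.1.1 hQ')

end LowerThreshold

/-! ### Transfer from Lebesgue measure to the law of the sample. -/

section AlmostSure

theorem ae_stable_centered {n p q : ℕ} (hp : 0 < p) (hq : 0 < q)
    (hn : (p : ℝ) / q + (q : ℝ) / p + 1 < n) {Ω : Type*} [MeasurableSpace Ω] (μ : Measure Ω)
    [IsProbabilityMeasure μ] (ν : Measure (Matrix (Fin p) (Fin q) ℝ))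
    (hν : ν ≪ matrixLebesgue p q) (X : Fin n → Ω → Matrix (Fin p) (Fin q) ℝ)
    (hlaw : ∀ i, HasLaw (X i) ν μ) (hindep : iIndepFun X μ) :
    ∀ᵐ ω ∂μ, Stable (centered fun i => X i ω) := by
  have hp' : (0 : ℝ) < p := by positivity
  have hq' : (0 : ℝ) < q := by positivity
  obtain ⟨m, rfl⟩ : ∃ m, n = m + 1 := by
    refine Nat.exists_eq_succ_of_ne_zero ?_
    rintro rfl
    have : 0 < (p : ℝ) / q + (q : ℝ) / p + 1 := by positivity
    simp only [Nat.cast_zero] at hn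
    linarith
  have hm : p ^ 2 + q ^ 2 < m * (p * q) := by
    rw [Nat.cast_add, Nat.cast_one, add_lt_add_iff_right, div_add_div _ _ hq'.ne' hp'.ne',
      div_lt_iff₀ (by positivity)] at hn
    have : (p : ℝ) ^ 2 + q ^ 2 < m * (p * q) := by linarith
    exact_mod_cast this
  have hprob : IsProbabilityMeasure ν := by
    rw [← (hlaw 0).map_eq]
    exact Measure.isProbabilityMeasure_map (hlaw 0).aemeasurable
  have hjoint := hindep.hasLaw_pi hlaw
  have hσ : SigmaFinite (matrixLebesgue p q) :=
    inferInstanceAs (SigmaFinite (volume : Measure (Fin p → Fin q → ℝ)))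
  have hac := pi_absolutelyContinuous (fun _ : Fin (m + 1) => ν) (fun _ => matrixLebesgue p q)
    fun _ => hν
  have hnull : Measure.pi (fun _ : Fin (m + 1) => matrixLebesgue p q)
      {X | ¬ Stable (centered X)} = 0 := volume_not_stable hm
  have h1 : ∀ᵐ x ∂(Measure.pi fun _ : Fin (m + 1) => ν), Stable (centered x) := hac hnull
  rw [← hjoint.map_eq] at h1
  exact ae_of_ae_map hjoint.aemeasurable h1

end AlmostSure

end KroneckerMLE

theorem theorem1 (n p q : ℕ) (hp : 0 < p) (hq : 0 < q)
    {Ω : Type*} [MeasurableSpace Ω] (μ : Measure Ω) [IsProbabilityMeasure μ]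
    (ν : Measure (Matrix (Fin p) (Fin q) ℝ))
    (hν : ν ≪ KroneckerMLE.matrixLebesgue p q)
    (X : Fin n → Ω → Matrix (Fin p) (Fin q) ℝ)
    (hlaw : ∀ i, HasLaw (X i) ν μ) (hindep : iIndepFun X μ) :
    -- below the lower threshold there is no unique minimum, whatever the sample
    ((n : ℝ) < max ((p : ℝ) / q) ((q : ℝ) / p) + 1 →
      ∀ ω, ¬ ∃! θ, KroneckerMLE.IsMLE (fun i => X i ω) θ) ∧
    -- above the upper threshold there is almost surely a unique minimum
    ((p : ℝ) / q + (q : ℝ) / p + 1 < n →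
      ∀ᵐ ω ∂μ, ∃! θ, KroneckerMLE.IsMLE (fun i => X i ω) θ) ∧
    -- above the upper threshold the flip-flop iteration almost surely stays in the constraint set
    -- and converges to the minimum, from every starting point
    ((p : ℝ) / q + (q : ℝ) / p + 1 < n →
      ∀ᵐ ω ∂μ, ∀ θ, KroneckerMLE.IsMLE (fun i => X i ω) θ →
        ∀ PQ₀ ∈ KroneckerMLE.covPairs p q,
          (∀ j, KroneckerMLE.flipFlop (fun i => X i ω) PQ₀ j ∈ KroneckerMLE.covPairs p q) ∧
          Tendsto (fun j =>
              (KroneckerMLE.sampleMean (fun i => X i ω),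
                (KroneckerMLE.flipFlop (fun i => X i ω) PQ₀ j).1,
                KroneckerMLE.updateQ (fun i => X i ω)
                  (KroneckerMLE.flipFlop (fun i => X i ω) PQ₀ j).1))
            atTop (𝓝 θ) ∧
          Tendsto (fun j =>
              (KroneckerMLE.specNorm (KroneckerMLE.flipFlop (fun i => X i ω) PQ₀ j).2)⁻¹ •
                (KroneckerMLE.flipFlop (fun i => X i ω) PQ₀ j).2)
            atTop (𝓝 ((KroneckerMLE.specNorm θ.2.2)⁻¹ • θ.2.2))) := by
  have hpos : (p : ℝ) / q + (q : ℝ) / p + 1 < n → 0 < n := fun h => by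
    have : 0 ≤ (p : ℝ) / q + (q : ℝ) / p := by positivity
    exact_mod_cast (by linarith : (0 : ℝ) < n)
  refine ⟨fun hn ω ⟨θ, hθ, _⟩ => KroneckerMLE.not_isMLE_of_lt hp hq hn hθ, fun hn => ?_,
    fun hn => ?_⟩
  · filter_upwards [KroneckerMLE.ae_stable_centered hp hq hn μ ν hν X hlaw hindep] with ω hω
    exact KroneckerMLE.existsUnique_isMLE (hpos hn) hp hq hω
  · filter_upwards [KroneckerMLE.ae_stable_centered hp hq hn μ ν hν X hlaw hindep] with ω hω
    exact fun θ hθ PQ₀ h₀ => KroneckerMLE.flipFlop_converges (hpos hn) hp hq hω hθ h₀
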